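/- A (proper) linear 3-periodic net in $\mathbb{R}^3$ is a pair $\mathcal N=(N,S)$ where $S$ is a countable set of nondegenerate line segments (edges), any two of which meet at most in a common endpoint, $N$ (the nodes) is the set of endpoints of members of $S$, and there is a basis of $\mathbb{R}^3$ (a periodicity basis) whose translation group $\mathcal T$ leaves $N$ and $S$ invariant, with finitely many $\mathcal T$-orbits in $N$ and in $S$. The body $|\mathcal N|$ is the union of the edges. The structure graph of $\mathcal N$ has vertex set $N$, with $p,q$ adjacent if $[p,q]\in S$; $\mathcal N$ is connected if this graph is. A periodicity basis is primitive if its translation group is maximal under inclusion among those of periodicity bases. Given a periodicity basis $\underline a$ and representatives $F_v$ of the translation classes of nodes, each edge $[v+\sum k_ia_i,\,w+\sum l_ia_i]$ with $v,w\in F_v$, $k,l\in\mathbb{Z}^3$ gives an edge from $v$ to $w$ of the labelled quotient graph, with label $k-l$. The quotient graph of $\mathcal N$ is the underlying multigraph for a primitive $\underline a$. The adjacency depth of $\mathcal N$ is the minimum, over the labelled quotient graphs for primitive periodicity bases, of the maximum modulus of the coordinates of the edge labels. Nets $\mathcal N_0,\mathcal N_1$ are periodically isotopic if there are linear 3-periodic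 nets $\mathcal N_t$ $(0\le t\le 1)$ joining them, right-handed periodicity bases $\underline a^t$ of $\mathcal N_t$ depending continuously on $t$, and bijections $f_t:|\mathcal N_0|\to|\mathcal N_t|$ taking nodes to nodes such that $f_0$ is the identity, $t\mapsto f_t(p)$ is continuous for each node $p$, and $f_t$ maps each edge $[a,b]$ of $\mathcal N_0$ affinely onto an edge $[f_t(a),f_t(b)]$ of $\mathcal N_t$. They are orientedly affinely equivalent if some translates of them correspond under a matrix in $GL^+(3,\mathbb{R})$. For a finite set $W\subset\mathbb{Z}^3$ let $\mathcal M(W)$ be the pair with node set $\mathbb{Z}^3$ and edges $[k,k+w]$, $k\in\mathbb{Z}^3$, $w\in W$. Write $a_x=(1,0,0)$, $a_y=(0,1,0)$, $a_z=(0,0,1)$, $f_x=(0,1,1)$, $f_y=(1,0,1)$, $f_z=(1,1,0)$, $g_x=(0,1,-1)$, $g_y=(1,0,-1)$, $g_z=(1,-1,0)$, $d=(1,1,1)$. **Corollary.** On the connected linear 3-periodic nets in $\mathbb{R}^3$ with adjacency depth $1$ and a single-vertex quotient graph, periodic isotopy is an equivalence relation with exactly 19 classes. Moreover the 19 pairs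 $\mathcal M(W)$, with $W$ the set of letters of one of the words $a_xa_ya_z$; $a_xa_ya_zd$; $a_xa_ya_zf_x$; $a_xa_yg_xd$; $a_xg_xg_yd$; $a_xg_yg_zd$; $a_xa_ya_zf_xf_y$; $a_xa_ya_zg_xd$; $a_xa_yg_xg_yd$; $a_xa_yg_xg_zd$; $a_xg_xg_yg_zd$; $a_xa_ya_zf_xf_yf_z$; $a_xa_ya_zg_xg_yg_z$; $a_xa_ya_zg_xg_yd$; $a_xa_yg_xg_yf_zd$; $a_xa_yg_xg_yg_zd$; $a_xa_ya_zf_xf_yf_zd$; $a_xa_ya_zg_xg_yf_zd$; $a_xa_ya_zg_xg_yg_zd$, are nets of this kind, every net of this kind is orientedly affinely equivalent to one of them (so there are at most 19 oriented affine equivalence classes), and their structure graphs are pairwise non-isomorphic. -/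

import Mathlib

namespace PeriodicNets

/-- Three-dimensional real space. Only its affine, topological and orientation structure is used,
never a metric. -/
abbrev R3 : Type := Fin 3 → ℝ

/-- The closed line segment `[p, q]` spanned by an unordered pair of points. -/
def segmentOf (e : Sym2 R3) : Set R3 :=
  Sym2.lift ⟨fun p q => segment ℝ p q, fun p q => segment_symm ℝ p q⟩ e

/-- The lattice vector `k₁ a₁ + k₂ a₂ + k₃ a₃`. -/
def latticeVector (a : Fin 3 → R3) (k : Fin 3 → ℤ) : R3 := ∑ i, k i • a i

/-- The translation group of a triple of vectors, as its set of translation vectors. -/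
def translationLattice (a : Fin 3 → R3) : Set R3 := Set.range (latticeVector a)

/-- The translate of a segment by a vector. -/
def translateEdge (v : R3) (e : Sym2 R3) : Sym2 R3 := e.map (fun p => p + v)

/-- The triple `a` is a basis of `ℝ³` whose translation group leaves the set `nodes` of points and
the set `edges` of segments invariant. -/
def IsPeriodBasis (nodes : Set R3) (edges : Set (Sym2 R3)) (a : Fin 3 → R3) : Prop :=
  LinearIndependent ℝ a ∧
  (∀ v ∈ translationLattice a, ∀ p ∈ nodes, p + v ∈ nodes) ∧
  (∀ v ∈ translationLattice a, ∀ e ∈ edges, translateEdge v e ∈ edges)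

/-- A (proper) linear 3-periodic net in `ℝ³`; a segment `[p, q]` is recorded as the unordered pair
of its endpoints. It need not be connected. -/
structure LinearPeriodicNet where
  nodes : Set R3
  edges : Set (Sym2 R3)
  edges_countable : edges.Countable
  edges_nondegenerate : ∀ e ∈ edges, ¬ e.IsDiag
  /-- Distinct edges meet at most in a common endpoint. -/
  essentially_disjoint : ∀ e ∈ edges, ∀ e' ∈ edges, e ≠ e' →
    ∀ x ∈ segmentOf e ∩ segmentOf e', x ∈ e ∧ x ∈ e'
  nodes_eq : nodes = {p | ∃ e ∈ edges, p ∈ e}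
  /-- Invariance under a full-rank translation group with finitely many orbits of nodes and
  of edges. -/
  periodic : ∃ a : Fin 3 → R3, IsPeriodBasis nodes edges a ∧
    (∃ F : Set R3, F.Finite ∧ ∀ p ∈ nodes, ∃ q ∈ F, ∃ v ∈ translationLattice a, p = q + v) ∧
    (∃ F : Set (Sym2 R3), F.Finite ∧
      ∀ e ∈ edges, ∃ e₀ ∈ F, ∃ v ∈ translationLattice a, e = translateEdge v e₀)

namespace LinearPeriodicNet

/-- `a` is a periodicity basis of the net. -/
def IsPeriodicityBasis (N : LinearPeriodicNet) (a : Fin 3 → R3) : Prop :=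
  IsPeriodBasis N.nodes N.edges a

/-- A periodicity basis is primitive if its translation group is not properly contained in that of
another periodicity basis. -/
def IsPrimitiveBasis (N : LinearPeriodicNet) (a : Fin 3 → R3) : Prop :=
  N.IsPeriodicityBasis a ∧
  ∀ b : Fin 3 → R3, N.IsPeriodicityBasis b → ¬ translationLattice a ⊂ translationLattice b

/-- The body `|N|`: the union of all edges. -/
def body (N : LinearPeriodicNet) : Set R3 := ⋃ e ∈ N.edges, segmentOf e

/-- The structure graph `G(N)`. -/
def structureGraph (N : LinearPeriodicNet) : SimpleGraph N.nodes where
  Adj p q := s(p.1, q.1) ∈ N.edges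
  symm := ⟨fun p q h => by rw [Sym2.eq_swap]; exact h⟩
  loopless := ⟨fun p h => N.edges_nondegenerate _ h (Sym2.mk_isDiag_iff.mpr rfl)⟩

/-- The net is connected. -/
def IsConnected (N : LinearPeriodicNet) : Prop := N.structureGraph.Connected

/-- `F` is a complete set of representatives for the translation classes of nodes with respect
to the periodicity basis `a`. It serves as the vertex set of the (labelled) quotient graph. -/
def IsNodeMotif (N : LinearPeriodicNet) (a : Fin 3 → R3) (F : Set R3) : Prop :=
  F ⊆ N.nodes ∧ ∀ p ∈ N.nodes, ∃! v, v ∈ F ∧ ∃ k, p = v + latticeVector a k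

/-- The labelled directed edges `(v, w, k - l)` of the labelled quotient graph of the net for the
periodicity basis `a` and vertex set `F`, one for each edge `[v + k·a, w + l·a]` of the net. Each edge is
recorded in both directions, `(v, w, m)` being the same edge as `(w, v, -m)`. -/
def labelledQuotientEdges (N : LinearPeriodicNet) (a : Fin 3 → R3) (F : Set R3) :
    Set (R3 × R3 × (Fin 3 → ℤ)) :=
  {x | x.1 ∈ F ∧ x.2.1 ∈ F ∧ ∃ k l : Fin 3 → ℤ,
    s(x.1 + latticeVector a k, x.2.1 + latticeVector a l) ∈ N.edges ∧ x.2.2 = k - l}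

/-- The maximum modulus of the coordinates of a label. -/
def labelModulus (m : Fin 3 → ℤ) : ℕ := Finset.univ.sup fun i => (m i).natAbs

/-- The depth of the labelled quotient graph: the maximum modulus of its edge labels. -/
noncomputable def quotientDepth (N : LinearPeriodicNet) (a : Fin 3 → R3) (F : Set R3) : ℕ∞ :=
  ⨆ x ∈ N.labelledQuotientEdges a F, (labelModulus x.2.2 : ℕ∞)

/-- The adjacency depth: the minimum depth of the labelled quotient graphs for primitive
periodicity bases. (If there is one class of nodes, the labels do not depend on the
representatives `F`.) -/
noncomputable def adjacencyDepth (N : LinearPeriodicNet) : ℕ∞ :=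
  ⨅ (a : Fin 3 → R3) (_ : N.IsPrimitiveBasis a) (F : Set R3) (_ : N.IsNodeMotif a F),
    N.quotientDepth a F

/-- The quotient graph of the net, taken for a primitive periodicity basis, has one vertex. -/
def HasSingleVertexQuotient (N : LinearPeriodicNet) : Prop :=
  ∃ (a : Fin 3 → R3) (v : R3), N.IsPrimitiveBasis a ∧ N.IsNodeMotif a {v}

end LinearPeriodicNet

/-- A triple of vectors is right-handed (in particular, a basis). -/
def IsRightHanded (a : Fin 3 → R3) : Prop := 0 < (Matrix.of a).det

/-- Oriented affine equivalence: some translates of the two nets correspond under a matrix of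
positive determinant. -/
def OrientedlyAffinelyEquivalent (N₁ N₂ : LinearPeriodicNet) : Prop :=
  ∃ (X : Matrix (Fin 3) (Fin 3) ℝ) (u₁ u₂ : R3), 0 < X.det ∧
    (fun p => X.mulVec (p + u₁)) '' N₁.nodes = (fun p => p + u₂) '' N₂.nodes ∧
    Sym2.map (fun p => X.mulVec (p + u₁)) '' N₁.edges = translateEdge u₂ '' N₂.edges

/-- Periodic isotopy of proper linear 3-periodic nets: a path `𝒩` of such nets from `N₀` to `N₁`,
a continuous path `a` of right-handed periodicity bases, and bijections
`f t : |N₀| → |𝒩 t|` taking nodes to nodes along continuous paths and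
edges affinely onto edges, with `f 0` the identity. (Only the values of `f t` on `|N₀|` matter.) -/
def PeriodicallyIsotopic (N₀ N₁ : LinearPeriodicNet) : Prop :=
  ∃ (𝒩 : unitInterval → LinearPeriodicNet) (a : unitInterval → Fin 3 → R3)
    (f : unitInterval → R3 → R3),
    𝒩 0 = N₀ ∧ 𝒩 1 = N₁ ∧
    Continuous a ∧
    (∀ t, (𝒩 t).IsPeriodicityBasis (a t) ∧ IsRightHanded (a t)) ∧
    (∀ t, Set.BijOn (f t) N₀.body (𝒩 t).body ∧ Set.MapsTo (f t) N₀.nodes (𝒩 t).nodes) ∧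
    (∀ x ∈ N₀.body, f 0 x = x) ∧
    (∀ p ∈ N₀.nodes, Continuous fun t => f t p) ∧
    (∀ t, ∀ p q : R3, s(p, q) ∈ N₀.edges →
      s(f t p, f t q) ∈ (𝒩 t).edges ∧
      ∀ c ∈ Set.Icc (0 : ℝ) 1,
        f t (AffineMap.lineMap p q c) = AffineMap.lineMap (f t p) (f t q) c)

/-- The connected linear 3-periodic nets with adjacency depth 1 and a single vertex quotient
graph. -/
abbrev DepthOneLatticeNet : Type :=
  {N : LinearPeriodicNet // N.IsConnected ∧ N.adjacencyDepth = 1 ∧ N.HasSingleVertexQuotient}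

/-- Inclusion of the integer points in `ℝ³`. -/
def intPoint (k : Fin 3 → ℤ) : R3 := fun i => (k i : ℝ)

/-- The set of all segments `[k, k + v]` with `k ∈ ℤ³` and `v` in the list `w`. -/
def modelEdges (w : List (Fin 3 → ℤ)) : Set (Sym2 R3) :=
  {e | ∃ (k : Fin 3 → ℤ) (v : Fin 3 → ℤ), v ∈ w ∧ e = s(intPoint k, intPoint (k + v))}

/-- The axial edge vectors `ax, ay, az`, the face diagonals `fx, fy, fz` and `gx, gy, gz`, and the
long diagonal `d`. -/
def ax : Fin 3 → ℤ := ![1, 0, 0]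
def ay : Fin 3 → ℤ := ![0, 1, 0]
def az : Fin 3 → ℤ := ![0, 0, 1]
def fx : Fin 3 → ℤ := ![0, 1, 1]
def fy : Fin 3 → ℤ := ![1, 0, 1]
def fz : Fin 3 → ℤ := ![1, 1, 0]
def gx : Fin 3 → ℤ := ![0, 1, -1]
def gy : Fin 3 → ℤ := ![1, 0, -1]
def gz : Fin 3 → ℤ := ![1, -1, 0]
def d : Fin 3 → ℤ := ![1, 1, 1]

/-- The edge words of the 19 model nets. -/
def modelWord : Fin 19 → List (Fin 3 → ℤ) :=
  ![[ax, ay, az],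
    [ax, ay, az, d],
    [ax, ay, az, fx],
    [ax, ay, gx, d],
    [ax, gx, gy, d],
    [ax, gy, gz, d],
    [ax, ay, az, fx, fy],
    [ax, ay, az, gx, d],
    [ax, ay, gx, gy, d],
    [ax, ay, gx, gz, d],
    [ax, gx, gy, gz, d],
    [ax, ay, az, fx, fy, fz],
    [ax, ay, az, gx, gy, gz],
    [ax, ay, az, gx, gy, d],
    [ax, ay, gx, gy, fz, d],
    [ax, ay, gx, gy, gz, d],
    [ax, ay, az, fx, fy, fz, d],
    [ax, ay, az, gx, gy, fz, d],
    [ax, ay, az, gx, gy, gz, d]]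

end PeriodicNets

namespace PeriodicNets

/-! Take a primitive basis whose quotient depth is at most 1 and a base node `v`. Since there is one
class of nodes, these are exactly the points `v` plus a lattice vector, and the edges are encoded by
a symmetric set `W` of nonzero vectors in the box `{-1, 0, 1}³`. Two edges whose vectors are
congruent modulo 2 have translates with a common midpoint, so disjointness of edges allows at most
one pair `±w` in each of the seven nonzero residue classes modulo 2 (`eq_or_eq_neg_of_congr`).
Connectedness says that `W` generates `ℤ³` (`eq_top_of_isConnected`). This leaves finitely many
sets, and a computation shows that each is the image of one of the 19 words under an integer matrix
of determinant `±1` (`exists_modelWord_of_generating`). As `W = -W`, that matrix may be replaced by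
its negative, so every net is an orientation preserving affine image of a model
(`exists_eq_affineImage_modelNet`).

Matrices of positive determinant form a path connected set, so two such images of the same model are
periodically isotopic (`periodicallyIsotopic_of_affineImages`). Conversely, the endpoint of an
isotopy induces an isomorphism of structure graphs (`PeriodicallyIsotopic.nonempty_iso`), and the
number of endpoints of walks of length 5 separates the 19 model graphs (`eq_of_structureGraph_iso`).
Hence the index of the model is a complete invariant. Periodic isotopy is equality of this index,
which makes it an equivalence relation without any concatenation of paths. -/

/-! ### Walk counts as an invariant of the model graphs -/

/-- The vertices at which walks of length `n` from `p` end. -/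
def walkEnds {V : Type*} (G : SimpleGraph V) (p : V) : ℕ → Set V
  | 0 => {p}
  | n + 1 => {q | ∃ r ∈ walkEnds G p n, G.Adj r q}

lemma walkEnds_iso {V V' : Type*} {G : SimpleGraph V} {H : SimpleGraph V'} (φ : G ≃g H) (p : V)
    (n : ℕ) : walkEnds H (φ p) n = φ '' walkEnds G p n := by
  induction n with
  | zero => simp [walkEnds]
  | succ n ih =>
    ext q
    simp only [walkEnds, ih, Set.mem_ofPred_eq, Set.mem_image]
    constructor
    · rintro ⟨_, ⟨r, hr, rfl⟩, h⟩
      refine ⟨φ.symm q, ⟨r, hr, ?_⟩, φ.apply_symm_apply q⟩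
      rw [← φ.map_adj_iff, φ.apply_symm_apply]
      exact h
    · rintro ⟨q, ⟨r, hr, h⟩, rfl⟩
      exact ⟨_, ⟨r, hr, rfl⟩, φ.map_adj_iff.mpr h⟩

/-- The vectors of a list together with their negatives. -/
def symmList (w : List (Fin 3 → ℤ)) : List (Fin 3 → ℤ) := w ++ w.map fun v => -v

lemma mem_symmList {w : List (Fin 3 → ℤ)} {v : Fin 3 → ℤ} :
    v ∈ symmList w ↔ v ∈ w ∨ -v ∈ w := by
  simp [symmList, neg_eq_iff_eq_neg]

lemma intPoint_injective : Function.Injective intPoint := by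
  intro k l h
  funext i
  simpa [intPoint] using congrFun h i

lemma intPoint_mem_modelEdges {w : List (Fin 3 → ℤ)} {k l : Fin 3 → ℤ} :
    s(intPoint k, intPoint l) ∈ modelEdges w ↔ l - k ∈ symmList w := by
  rw [mem_symmList]
  constructor
  · rintro ⟨m, v, hv, h⟩
    rw [Sym2.eq_iff, intPoint_injective.eq_iff, intPoint_injective.eq_iff,
      intPoint_injective.eq_iff, intPoint_injective.eq_iff] at h
    rcases h with ⟨rfl, rfl⟩ | ⟨rfl, rfl⟩
    · left; simpa using hv
    · right; simpa using hv
  · rintro (h | h)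
    · exact ⟨k, l - k, h, by simp⟩
    · exact ⟨l, -(l - k), h, by rw [Sym2.eq_swap]; simp⟩

/-- The sums of `n` vectors from a list. -/
def sumsOf (S : List (Fin 3 → ℤ)) : ℕ → Set (Fin 3 → ℤ)
  | 0 => {0}
  | n + 1 => {m | ∃ r ∈ sumsOf S n, ∃ s ∈ S, m = r + s}

/-- The structure graph is the Cayley graph of `ℤ³` for the symmetrised word, so each step of a walk
adds one vector of `symmList w`. -/
lemma walkEnds_structureGraph (N : LinearPeriodicNet) (w : List (Fin 3 → ℤ))
    (hn : N.nodes = Set.range intPoint) (he : N.edges = modelEdges w) (p : N.nodes)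
    (k : Fin 3 → ℤ) (hk : p.1 = intPoint k) (n : ℕ) :
    Subtype.val '' walkEnds N.structureGraph p n =
      (fun m => intPoint (k + m)) '' sumsOf (symmList w) n := by
  induction n with
  | zero => simp [walkEnds, sumsOf, hk]
  | succ n ih =>
    ext x
    simp only [Set.mem_image, walkEnds, sumsOf, Set.mem_ofPred_eq]
    constructor
    · rintro ⟨q, ⟨r, hr, hrq⟩, rfl⟩
      have hr' : r.1 ∈ Subtype.val '' walkEnds N.structureGraph p n := ⟨r, hr, rfl⟩
      rw [ih] at hr'
      obtain ⟨m, hm, hmr⟩ := hr'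
      obtain ⟨l, hl⟩ : q.1 ∈ Set.range intPoint := hn ▸ q.2
      change s(r.1, q.1) ∈ N.edges at hrq
      rw [he, ← hmr, ← hl, intPoint_mem_modelEdges] at hrq
      exact ⟨l - k, ⟨m, hm, _, hrq, by abel⟩, by rw [← hl]; simp⟩
    · rintro ⟨_, ⟨m, hm, s, hs, rfl⟩, rfl⟩
      have hr' : intPoint (k + m) ∈ Subtype.val '' walkEnds N.structureGraph p n := by
        rw [ih]; exact ⟨m, hm, rfl⟩
      obtain ⟨r, hr, hmr⟩ := hr'
      have hq : intPoint (k + (m + s)) ∈ N.nodes := by rw [hn]; exact ⟨_, rfl⟩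
      refine ⟨⟨_, hq⟩, ⟨r, hr, ?_⟩, rfl⟩
      change s(r.1, _) ∈ N.edges
      rw [he, hmr, intPoint_mem_modelEdges]
      convert hs using 1
      abel

lemma ncard_walkEnds (N : LinearPeriodicNet) (w : List (Fin 3 → ℤ))
    (hn : N.nodes = Set.range intPoint) (he : N.edges = modelEdges w) (p : N.nodes) (n : ℕ) :
    (walkEnds N.structureGraph p n).ncard = (sumsOf (symmList w) n).ncard := by
  obtain ⟨k, hk⟩ : p.1 ∈ Set.range intPoint := hn ▸ p.2
  rw [← Set.ncard_image_of_injective _ Subtype.val_injective,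
    walkEnds_structureGraph N w hn he p k hk.symm]
  exact Set.ncard_image_of_injective _ (intPoint_injective.comp (add_right_injective k))

lemma ncard_sumsOf_eq_of_iso {N N' : LinearPeriodicNet} {w w' : List (Fin 3 → ℤ)}
    (hn : N.nodes = Set.range intPoint) (he : N.edges = modelEdges w)
    (hn' : N'.nodes = Set.range intPoint) (he' : N'.edges = modelEdges w')
    (φ : N.structureGraph ≃g N'.structureGraph) (n : ℕ) :
    (sumsOf (symmList w) n).ncard = (sumsOf (symmList w') n).ncard := by
  have hp : intPoint 0 ∈ N.nodes := by rw [hn]; exact ⟨_, rfl⟩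
  rw [← ncard_walkEnds N w hn he ⟨_, hp⟩, ← ncard_walkEnds N' w' hn' he' (φ ⟨_, hp⟩),
    walkEnds_iso, Set.ncard_image_of_injective _ φ.injective]

/-- An additive encoding of integer vectors, injective on the box of radius 5. -/
def boxCode (k : Fin 3 → ℤ) : ℤ := k 0 + 11 * k 1 + 121 * k 2

/-- The set of the codes of sums of `n` vectors, shifted to be nonnegative, as a bit vector. -/
def sumBits (S : List (Fin 3 → ℤ)) : ℕ → ℕ
  | 0 => 1
  | n + 1 => S.foldr (fun s B => B ||| (sumBits S n <<< (boxCode s + 133).toNat)) 0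

lemma testBit_foldr_lor {α : Type*} (S : List α) (f : α → ℕ) (m : ℕ) :
    (S.foldr (fun s B => B ||| f s) 0).testBit m = true ↔ ∃ s ∈ S, (f s).testBit m = true := by
  induction S with
  | nil => simp
  | cons a S ih => simp [ih, or_comm]

lemma sumsOf_bound {S : List (Fin 3 → ℤ)} (hS : ∀ s ∈ S, ∀ i, |s i| ≤ 1) {n : ℕ}
    {m : Fin 3 → ℤ} (hm : m ∈ sumsOf S n) (i : Fin 3) : |m i| ≤ n := by
  induction n generalizing m with
  | zero => rw [sumsOf, Set.mem_singleton_iff] at hm; simp [hm]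
  | succ n ih =>
    obtain ⟨r, hr, s, hs, rfl⟩ := hm
    have h1 := ih hr
    have h2 := hS s hs i
    rw [abs_le] at *
    rw [Pi.add_apply]
    push_cast
    omega

/-- `boxCode` is additive, so adding `s` to all sums shifts the bit vector by the code of `s`. The
offset `133 = 1 + 11 + 121` per step makes every shift nonnegative. -/
lemma testBit_sumBits {S : List (Fin 3 → ℤ)} (hS : ∀ s ∈ S, ∀ i, |s i| ≤ 1) (n m : ℕ) :
    (sumBits S n).testBit m = true ↔ ∃ k ∈ sumsOf S n, boxCode k + 133 * n = m := by
  induction n generalizing m with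
  | zero =>
    rw [sumBits, Nat.testBit_one_eq_true_iff_self_eq_zero]
    simp [sumsOf, boxCode, eq_comm]
  | succ n ih =>
    have key : ∀ s ∈ S, ((boxCode s + 133).toNat : ℤ) = boxCode s + 133 := by
      intro s hs
      have h0 := hS s hs 0
      have h1 := hS s hs 1
      have h2 := hS s hs 2
      rw [abs_le] at h0 h1 h2
      rw [Int.toNat_of_nonneg]
      unfold boxCode
      omega
    rw [sumBits, testBit_foldr_lor]
    simp only [Nat.testBit_shiftLeft, Bool.and_eq_true, decide_eq_true_eq, ih]
    constructor
    · rintro ⟨s, hs, hle, k, hk, hkm⟩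
      refine ⟨k + s, ⟨k, hk, s, hs, rfl⟩, ?_⟩
      have := key s hs
      simp only [boxCode, Pi.add_apply] at *
      omega
    · rintro ⟨_, ⟨k, hk, s, hs, rfl⟩, hkm⟩
      have h := key s hs
      have b0 := sumsOf_bound hS hk 0
      have b1 := sumsOf_bound hS hk 1
      have b2 := sumsOf_bound hS hk 2
      rw [abs_le] at b0 b1 b2
      simp only [boxCode, Pi.add_apply] at *
      exact ⟨s, hs, by omega, k, hk, by omega⟩

/-- Sums of five vectors lie in the box of radius 5, where the base 11 code is injective. With the
total offset `665 = 5 * 133` the codes fill the range below `1331 = 11 ^ 3`. -/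
lemma ncard_sumsOf {S : List (Fin 3 → ℤ)} (hS : ∀ s ∈ S, ∀ i, |s i| ≤ 1) :
    (sumsOf S 5).ncard = ((List.range 1331).filter fun m => (sumBits S 5).testBit m).length := by
  have h : (fun k => (boxCode k + 665).toNat) '' sumsOf S 5 =
      (((List.range 1331).filter fun m => (sumBits S 5).testBit m).toFinset : Set ℕ) := by
    ext m
    simp only [Set.mem_image, List.coe_toFinset, List.mem_filter, List.mem_range,
      Set.mem_ofPred_eq, testBit_sumBits hS]
    constructor
    · rintro ⟨k, hk, rfl⟩
      have b0 := sumsOf_bound hS hk 0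
      have b1 := sumsOf_bound hS hk 1
      have b2 := sumsOf_bound hS hk 2
      rw [abs_le] at b0 b1 b2
      refine ⟨?_, k, hk, ?_⟩ <;> simp only [boxCode] at * <;> omega
    · rintro ⟨-, k, hk, h⟩
      exact ⟨k, hk, by push_cast at h; omega⟩
  rw [← List.toFinset_card_of_nodup (List.nodup_range.filter _), ← Set.ncard_coe_finset, ← h,
    Set.InjOn.ncard_image]
  intro k hk l hl hkl
  have a0 := sumsOf_bound hS hk 0
  have a1 := sumsOf_bound hS hk 1
  have a2 := sumsOf_bound hS hk 2
  have b0 := sumsOf_bound hS hl 0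
  have b1 := sumsOf_bound hS hl 1
  have b2 := sumsOf_bound hS hl 2
  rw [abs_le] at a0 a1 a2 b0 b1 b2
  simp only [boxCode] at hkl
  funext i
  fin_cases i <;> simp <;> omega

lemma modelWord_bound (i : Fin 19) : ∀ s ∈ symmList (modelWord i), ∀ j, |s j| ≤ 1 := by
  revert i
  decide +kernel

/-- The 19 cardinalities for walks of length 5 are evaluated and turn out to be distinct. -/
lemma sumBits_modelWord_injective (i j : Fin 19)
    (h : ((List.range 1331).filter fun m => (sumBits (symmList (modelWord i)) 5).testBit m).length =
      ((List.range 1331).filter fun m => (sumBits (symmList (modelWord j)) 5).testBit m).length) :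
    i = j := by
  have key : (List.finRange 19).map (fun i => ((List.range 1331).filter fun m =>
      (sumBits (symmList (modelWord i)) 5).testBit m).length) =
      [146, 216, 339, 431, 456, 336, 451, 521, 627, 641, 767, 601, 561, 719, 711, 859, 671, 791,
        909] := by
    decide +kernel
  have hn := (List.nodup_map_iff_inj_on (List.nodup_finRange 19)).1
    (key ▸ (by decide +kernel : List.Nodup [146, 216, 339, 431, 456, 336, 451, 521, 627, 641, 767,
      601, 561, 719, 711, 859, 671, 791, 909]))
  exact hn i (List.mem_finRange i) j (List.mem_finRange j) h

/-- The structure graphs of the model nets are pairwise nonisomorphic. -/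
lemma eq_of_structureGraph_iso {N N' : LinearPeriodicNet} {i j : Fin 19}
    (hn : N.nodes = Set.range intPoint) (he : N.edges = modelEdges (modelWord i))
    (hn' : N'.nodes = Set.range intPoint) (he' : N'.edges = modelEdges (modelWord j))
    (φ : N.structureGraph ≃g N'.structureGraph) : i = j := by
  have h := ncard_sumsOf_eq_of_iso hn he hn' he' φ 5
  rw [ncard_sumsOf (modelWord_bound i), ncard_sumsOf (modelWord_bound j)] at h
  exact sumBits_modelWord_injective i j h

/-! ### Path connectedness of the matrices of positive determinant -/

lemma joinedIn_det_pos_mul {n : Type*} [Fintype n] [DecidableEq n] {A B : Matrix n n ℝ}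
    (hA : JoinedIn {M : Matrix n n ℝ | 0 < M.det} 1 A)
    (hB : JoinedIn {M : Matrix n n ℝ | 0 < M.det} 1 B) :
    JoinedIn {M : Matrix n n ℝ | 0 < M.det} 1 (A * B) := by
  have h := (hA.mul hB).mono (V := {M : Matrix n n ℝ | 0 < M.det}) (by
    rintro _ ⟨M, hM, M', hM', rfl⟩
    change 0 < (M * M').det
    rw [Matrix.det_mul]
    exact mul_pos hM hM')
  rwa [one_mul] at h

lemma joinedIn_det_pos_transvection {n : Type*} [Fintype n] [DecidableEq n] {i j : n}
    (hij : i ≠ j) (c : ℝ) :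
    JoinedIn {M : Matrix n n ℝ | 0 < M.det} 1 (Matrix.transvection i j c) := by
  refine JoinedIn.ofLine (f := fun s => Matrix.transvection i j (s * c)) ?_ (by simp) (by simp) ?_
  · apply Continuous.continuousOn
    unfold Matrix.transvection
    refine continuous_const.add (continuous_matrix fun a b => ?_)
    simp only [Matrix.single_apply]
    split_ifs <;> fun_prop
  · rintro _ ⟨s, -, rfl⟩
    simp [Matrix.det_transvection_of_ne i j hij]

lemma joinedIn_det_pos_diagonal_of_pos {n : Type*} [Fintype n] [DecidableEq n] {e : n → ℝ}
    (he : ∀ i, 0 < e i) : JoinedIn {M : Matrix n n ℝ | 0 < M.det} 1 (Matrix.diagonal e) := by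
  refine JoinedIn.ofLine (f := fun s => Matrix.diagonal fun i => 1 - s + s * e i) ?_ (by simp)
    (by simp) ?_
  · apply Continuous.continuousOn
    exact Continuous.matrix_diagonal (by fun_prop)
  · rintro _ ⟨s, ⟨h0, h1⟩, rfl⟩
    change 0 < (Matrix.diagonal fun i => 1 - s + s * e i).det
    rw [Matrix.det_diagonal]
    refine Finset.prod_pos fun i _ => ?_
    rcases eq_or_lt_of_le h0 with rfl | h
    · simp
    · have := mul_pos h (he i)
      linarith

/-- Positive determinant means that none or exactly two of the entries are negative. Two signs can
be removed together by a half turn, which is reached through transvections. -/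
lemma joinedIn_det_pos_diagonal {e : Fin 3 → ℝ} (he : 0 < (Matrix.diagonal e).det) :
    JoinedIn {M : Matrix (Fin 3) (Fin 3) ℝ | 0 < M.det} 1 (Matrix.diagonal e) := by
  -- The product of three transvections is a quarter turn in the `i, j` plane; its square has `-1`
  -- at `i` and `j`.
  have half (i j : Fin 3) (hij : i ≠ j) (s : Fin 3 → ℝ)
      (h : Matrix.diagonal s = (Matrix.transvection i j 1 * (Matrix.transvection j i (-1) *
        Matrix.transvection i j 1)) * (Matrix.transvection i j 1 *
        (Matrix.transvection j i (-1) * Matrix.transvection i j 1))) :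
      JoinedIn {M : Matrix (Fin 3) (Fin 3) ℝ | 0 < M.det} 1 (Matrix.diagonal s) := by
    have h1 := joinedIn_det_pos_transvection hij (1 : ℝ)
    have h2 := joinedIn_det_pos_transvection hij.symm (-1 : ℝ)
    have h3 := joinedIn_det_pos_mul h1 (joinedIn_det_pos_mul h2 h1)
    rw [h]
    exact joinedIn_det_pos_mul h3 h3
  -- Here `s` is the sign vector of `e`, and `diagonal e` factors as `diagonal s` times a positive
  -- diagonal matrix.
  have split (s : Fin 3 → ℝ) (hs : ∀ i, 0 < s i * e i) (hs' : ∀ i, s i * s i = 1)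
      (h : JoinedIn {M : Matrix (Fin 3) (Fin 3) ℝ | 0 < M.det} 1 (Matrix.diagonal s)) :
      JoinedIn {M : Matrix (Fin 3) (Fin 3) ℝ | 0 < M.det} 1 (Matrix.diagonal e) := by
    have := joinedIn_det_pos_mul h (joinedIn_det_pos_diagonal_of_pos hs)
    rw [Matrix.diagonal_mul_diagonal] at this
    simpa only [← mul_assoc, hs', one_mul] using this
  rw [Matrix.det_diagonal, Fin.prod_univ_three] at he
  have h0 : e 0 ≠ 0 := by rintro h; simp [h] at he
  have h1 : e 1 ≠ 0 := by rintro h; simp [h] at he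
  have h2 : e 2 ≠ 0 := by rintro h; simp [h] at he
  rcases lt_or_gt_of_ne h0 with h0 | h0 <;> rcases lt_or_gt_of_ne h1 with h1 | h1 <;>
    rcases lt_or_gt_of_ne h2 with h2 | h2
  · exact absurd he (mul_neg_of_pos_of_neg (mul_pos_of_neg_of_neg h0 h1) h2).not_gt
  · refine split ![-1, -1, 1] ?_ ?_ (half 0 1 (by decide) _ ?_)
    · intro i; fin_cases i <;> simp [*]
    · intro i; fin_cases i <;> simp
    · ext i j; fin_cases i <;> fin_cases j <;>
        simp [Matrix.transvection, Matrix.mul_apply, Fin.sum_univ_three, Matrix.one_apply,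
          Matrix.single_apply]
  · refine split ![-1, 1, -1] ?_ ?_ (half 0 2 (by decide) _ ?_)
    · intro i; fin_cases i <;> simp [*]
    · intro i; fin_cases i <;> simp
    · ext i j; fin_cases i <;> fin_cases j <;>
        simp [Matrix.transvection, Matrix.mul_apply, Fin.sum_univ_three, Matrix.one_apply,
          Matrix.single_apply]
  · exact absurd he (mul_neg_of_neg_of_pos (mul_neg_of_neg_of_pos h0 h1) h2).not_gt
  · refine split ![1, -1, -1] ?_ ?_ (half 1 2 (by decide) _ ?_)
    · intro i; fin_cases i <;> simp [*]
    · intro i; fin_cases i <;> simp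
    · ext i j; fin_cases i <;> fin_cases j <;>
        simp [Matrix.transvection, Matrix.mul_apply, Fin.sum_univ_three, Matrix.one_apply,
          Matrix.single_apply]
  · exact absurd he (mul_neg_of_neg_of_pos (mul_neg_of_pos_of_neg h0 h1) h2).not_gt
  · exact absurd he (mul_neg_of_pos_of_neg (mul_pos h0 h1) h2).not_gt
  · refine joinedIn_det_pos_diagonal_of_pos fun i => ?_
    fin_cases i <;> assumption

/-- The group of real `3 × 3` matrices with positive determinant is path connected. -/
lemma joinedIn_det_pos {M : Matrix (Fin 3) (Fin 3) ℝ} (hM : 0 < M.det) :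
    JoinedIn {M : Matrix (Fin 3) (Fin 3) ℝ | 0 < M.det} 1 M := by
  obtain ⟨L, L', D, rfl⟩ := Matrix.Pivot.exists_list_transvec_mul_diagonal_mul_list_transvec M
  have hL (L : List (Matrix.TransvectionStruct (Fin 3) ℝ)) :
      JoinedIn {M : Matrix (Fin 3) (Fin 3) ℝ | 0 < M.det} 1
        (L.map Matrix.TransvectionStruct.toMatrix).prod := by
    induction L with
    | nil => simpa using JoinedIn.refl (by simp)
    | cons t L ih =>
      rw [List.map_cons, List.prod_cons]
      exact joinedIn_det_pos_mul (joinedIn_det_pos_transvection t.hij t.c) ih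
  refine joinedIn_det_pos_mul (joinedIn_det_pos_mul (hL L) (joinedIn_det_pos_diagonal ?_)) (hL L')
  simpa [Matrix.det_mul, Matrix.TransvectionStruct.det_toMatrix_prod] using hM

/-! ### Affine images of nets -/

lemma linearIndependent_iff_det_ne_zero (a : Fin 3 → R3) :
    LinearIndependent ℝ a ↔ (Matrix.of a).det ≠ 0 := by
  rw [← isUnit_iff_ne_zero, ← Matrix.isUnit_iff_isUnit_det,
    ← Matrix.linearIndependent_rows_iff_isUnit]
  rfl

/-- The affine map `p ↦ A p + v`. -/
def affMap (A : Matrix (Fin 3) (Fin 3) ℝ) (v : R3) : R3 →ᵃ[ℝ] R3 :=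
  A.mulVecLin.toAffineMap + AffineMap.const ℝ R3 v

lemma affMap_apply (A : Matrix (Fin 3) (Fin 3) ℝ) (v p : R3) :
    affMap A v p = A.mulVec p + v := rfl

lemma affMap_injective {A : Matrix (Fin 3) (Fin 3) ℝ} (hA : A.det ≠ 0) (v : R3) :
    Function.Injective (affMap A v) := by
  intro p q h
  rw [affMap_apply, affMap_apply, add_left_inj] at h
  exact Matrix.mulVec_injective_iff_isUnit.mpr
    ((Matrix.isUnit_iff_isUnit_det A).mpr (isUnit_iff_ne_zero.mpr hA)) h

lemma affMap_mul (A B : Matrix (Fin 3) (Fin 3) ℝ) (u v p : R3) :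
    affMap (A * B) (A.mulVec u + v) p = affMap A v (affMap B u p) := by
  simp [affMap_apply, Matrix.mulVec_add, add_assoc]

lemma affMap_one_zero : ⇑(affMap 1 0) = id := by
  funext p
  simp [affMap_apply]

lemma segmentOf_map (f : R3 →ᵃ[ℝ] R3) (e : Sym2 R3) :
    segmentOf (e.map f) = f '' segmentOf e := by
  induction e with
  | _ p q => exact (image_segment ℝ f p q).symm

lemma mem_segmentOf_of_mem {p : R3} {e : Sym2 R3} (h : p ∈ e) : p ∈ segmentOf e := by
  obtain ⟨q, rfl⟩ := h
  exact left_mem_segment ℝ p q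

lemma latticeVector_mulVec (A : Matrix (Fin 3) (Fin 3) ℝ) (a : Fin 3 → R3) (k : Fin 3 → ℤ) :
    latticeVector (fun i => A.mulVec (a i)) k = A.mulVec (latticeVector a k) := by
  have := map_sum A.mulVecLin (fun i => k i • a i) Finset.univ
  simp only [map_zsmul, Matrix.mulVecLin_apply] at this
  exact this.symm

lemma of_mulVec (A : Matrix (Fin 3) (Fin 3) ℝ) (a : Fin 3 → R3) :
    Matrix.of (fun i => A.mulVec (a i)) = Matrix.of a * A.transpose := by
  ext i j
  simp [Matrix.mul_apply, Matrix.mulVec, dotProduct, mul_comm]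

lemma affMap_translate (A : Matrix (Fin 3) (Fin 3) ℝ) (v p x : R3) :
    affMap A v (p + x) = affMap A v p + A.mulVec x := by
  simp [affMap_apply, Matrix.mulVec_add, add_right_comm]

lemma map_affMap_translateEdge (A : Matrix (Fin 3) (Fin 3) ℝ) (v x : R3) (e : Sym2 R3) :
    (translateEdge x e).map (affMap A v) = translateEdge (A.mulVec x) (e.map (affMap A v)) := by
  simp only [translateEdge, Sym2.map_map]
  congr 1
  funext p
  exact affMap_translate A v p x

lemma IsPeriodBasis.affMap {A : Matrix (Fin 3) (Fin 3) ℝ} (hA : A.det ≠ 0) (v : R3)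
    {nodes : Set R3} {edges : Set (Sym2 R3)} {a : Fin 3 → R3} (h : IsPeriodBasis nodes edges a) :
    IsPeriodBasis (affMap A v '' nodes) (Sym2.map (affMap A v) '' edges)
      (fun i => A.mulVec (a i)) := by
  obtain ⟨h1, h2, h3⟩ := h
  refine ⟨?_, ?_, ?_⟩
  · rw [linearIndependent_iff_det_ne_zero] at h1 ⊢
    rw [of_mulVec, Matrix.det_mul, Matrix.det_transpose]
    exact mul_ne_zero h1 hA
  · rintro _ ⟨k, rfl⟩ _ ⟨p, hp, rfl⟩
    rw [latticeVector_mulVec, ← affMap_translate]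
    exact ⟨_, h2 _ ⟨k, rfl⟩ p hp, rfl⟩
  · rintro _ ⟨k, rfl⟩ _ ⟨e, he, rfl⟩
    rw [latticeVector_mulVec, ← map_affMap_translateEdge]
    exact ⟨_, h3 _ ⟨k, rfl⟩ e he, rfl⟩

namespace LinearPeriodicNet

/-- The image of a net under an invertible affine map. -/
def affineImage (N : LinearPeriodicNet) (A : Matrix (Fin 3) (Fin 3) ℝ) (v : R3)
    (hA : A.det ≠ 0) : LinearPeriodicNet where
  nodes := affMap A v '' N.nodes
  edges := Sym2.map (affMap A v) '' N.edges
  edges_countable := N.edges_countable.image _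
  edges_nondegenerate := by
    rintro _ ⟨e, he, rfl⟩ h
    exact N.edges_nondegenerate e he ((Sym2.isDiag_map (affMap_injective hA v)).mp h)
  essentially_disjoint := by
    rintro _ ⟨e, he, rfl⟩ _ ⟨e', he', rfl⟩ hne x ⟨hx, hx'⟩
    rw [segmentOf_map] at hx hx'
    obtain ⟨y, hy, rfl⟩ := hx
    rw [(affMap_injective hA v).mem_set_image] at hx'
    have := N.essentially_disjoint e he e' he' (by rintro rfl; exact hne rfl) y ⟨hy, hx'⟩
    exact ⟨Sym2.mem_map.mpr ⟨y, this.1, rfl⟩, Sym2.mem_map.mpr ⟨y, this.2, rfl⟩⟩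
  nodes_eq := by
    ext p
    rw [N.nodes_eq]
    constructor
    · rintro ⟨q, ⟨e, he, hq⟩, rfl⟩
      exact ⟨_, ⟨e, he, rfl⟩, Sym2.mem_map.mpr ⟨q, hq, rfl⟩⟩
    · rintro ⟨_, ⟨e, he, rfl⟩, hp⟩
      obtain ⟨q, hq, rfl⟩ := Sym2.mem_map.mp hp
      exact ⟨q, ⟨e, he, hq⟩, rfl⟩
  periodic := by
    obtain ⟨a, ha, ⟨F, hF, hF'⟩, E, hE, hE'⟩ := N.periodic
    refine ⟨_, ha.affMap hA v, ⟨affMap A v '' F, hF.image _, ?_⟩,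
      ⟨Sym2.map (affMap A v) '' E, hE.image _, ?_⟩⟩
    · rintro _ ⟨p, hp, rfl⟩
      obtain ⟨q, hq, _, ⟨k, rfl⟩, rfl⟩ := hF' p hp
      exact ⟨_, ⟨q, hq, rfl⟩, _, ⟨k, rfl⟩, by rw [latticeVector_mulVec, affMap_translate]⟩
    · rintro _ ⟨e, he, rfl⟩
      obtain ⟨e₀, he₀, _, ⟨k, rfl⟩, rfl⟩ := hE' e he
      exact ⟨_, ⟨e₀, he₀, rfl⟩, _, ⟨k, rfl⟩, by
        rw [latticeVector_mulVec, map_affMap_translateEdge]⟩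

lemma ext_nodes_edges {N N' : LinearPeriodicNet} (hn : N.nodes = N'.nodes)
    (he : N.edges = N'.edges) : N = N' := by
  cases N; cases N'
  simp only at hn he
  subst hn he
  rfl

lemma affineImage_one_zero (N : LinearPeriodicNet) (h : (1 : Matrix (Fin 3) (Fin 3) ℝ).det ≠ 0) :
    N.affineImage 1 0 h = N := by
  apply ext_nodes_edges
  · simp [affineImage, affMap_one_zero]
  · simp [affineImage, affMap_one_zero]

lemma affineImage_affineImage (N : LinearPeriodicNet) (A B : Matrix (Fin 3) (Fin 3) ℝ) (u v : R3)
    (hA : A.det ≠ 0) (hB : B.det ≠ 0) :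
    (N.affineImage B u hB).affineImage A v hA =
      N.affineImage (A * B) (A.mulVec u + v) (by simp [hA, hB]) := by
  have h : ⇑(affMap (A * B) (A.mulVec u + v)) = affMap A v ∘ affMap B u := by
    funext p
    exact affMap_mul A B u v p
  apply ext_nodes_edges
  · simp only [affineImage, h, Set.image_comp]
  · simp only [affineImage, h, Sym2.map_comp, Set.image_comp]

lemma body_affineImage (N : LinearPeriodicNet) (A : Matrix (Fin 3) (Fin 3) ℝ) (v : R3)
    (hA : A.det ≠ 0) : (N.affineImage A v hA).body = affMap A v '' N.body := by
  simp only [body, affineImage, Set.image_iUnion, Set.biUnion_image, segmentOf_map]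

/-- In odd dimension, negating a left-handed basis makes it right-handed and keeps its lattice. -/
lemma exists_rightHanded_basis (N : LinearPeriodicNet) :
    ∃ a, N.IsPeriodicityBasis a ∧ IsRightHanded a := by
  obtain ⟨a, ha, -⟩ := N.periodic
  rcases lt_or_gt_of_ne ((linearIndependent_iff_det_ne_zero a).mp ha.1) with h | h
  · have hneg (x : R3) : (-1 : Matrix (Fin 3) (Fin 3) ℝ).mulVec x = -x := by
      rw [Matrix.neg_mulVec, Matrix.one_mulVec]
    have hlat (k : Fin 3 → ℤ) : -latticeVector a k = latticeVector a (-k) := by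
      simp only [latticeVector, Pi.neg_apply, neg_smul, Finset.sum_neg_distrib]
    have hdet : 0 < (Matrix.of fun i => (-1 : Matrix (Fin 3) (Fin 3) ℝ).mulVec (a i)).det := by
      rw [of_mulVec, Matrix.transpose_neg, Matrix.transpose_one, mul_neg, mul_one, Matrix.det_neg]
      norm_num
      exact h
    refine ⟨_, ⟨(linearIndependent_iff_det_ne_zero _).mpr hdet.ne', ?_, ?_⟩, hdet⟩
    · rintro _ ⟨k, rfl⟩ p hp
      rw [latticeVector_mulVec, hneg, hlat]
      exact ha.2.1 _ ⟨-k, rfl⟩ p hp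
    · rintro _ ⟨k, rfl⟩ p hp
      rw [latticeVector_mulVec, hneg, hlat]
      exact ha.2.2 _ ⟨-k, rfl⟩ p hp
  · exact ⟨a, ha, h⟩

/-- A net is periodically isotopic to its images under orientation preserving affine maps. -/
lemma periodicallyIsotopic_affineImage (N : LinearPeriodicNet) {Y : Matrix (Fin 3) (Fin 3) ℝ}
    (hY : 0 < Y.det) (c : R3) : PeriodicallyIsotopic N (N.affineImage Y c hY.ne') := by
  obtain ⟨γ, hγ⟩ := joinedIn_det_pos hY
  obtain ⟨a, ha, hr⟩ := N.exists_rightHanded_basis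
  have hpos (t : unitInterval) : 0 < (γ t).det := hγ t
  -- The linear part follows a path of matrices from 1 to `Y` while the translation part grows
  -- linearly from 0 to `c`; net, basis and body are all carried along by the same affine map.
  refine ⟨fun t => N.affineImage (γ t) ((t : ℝ) • c) (hpos t).ne',
    fun t i => (γ t).mulVec (a i), fun t => affMap (γ t) ((t : ℝ) • c), ?_, ?_, ?_, ?_, ?_, ?_,
    ?_, ?_⟩
  · simp only [γ.source, Set.Icc.coe_zero, zero_smul, affineImage_one_zero]
  · simp only [γ.target, Set.Icc.coe_one, one_smul]
  · exact continuous_pi fun i => Continuous.matrix_mulVec γ.continuous continuous_const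
  · refine fun t => ⟨IsPeriodBasis.affMap (hpos t).ne' _ ha, ?_⟩
    rw [IsRightHanded, of_mulVec, Matrix.det_mul, Matrix.det_transpose]
    exact mul_pos hr (hpos t)
  · refine fun t => ⟨?_, fun p hp => ⟨p, hp, rfl⟩⟩
    rw [body_affineImage]
    exact (affMap_injective (hpos t).ne' _).injOn.bijOn_image
  · intro x _
    simp [affMap_apply]
  · intro p _
    simp only [affMap_apply]
    exact (Continuous.matrix_mulVec γ.continuous continuous_const).add (by fun_prop)
  · intro t p q h
    exact ⟨⟨_, h, rfl⟩, fun s _ => AffineMap.apply_lineMap _ p q s⟩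

end LinearPeriodicNet

/-! ### Periodic isotopy preserves the structure graph -/

/-- The endpoint map of a periodic isotopy is an isomorphism of structure graphs. -/
lemma PeriodicallyIsotopic.nonempty_iso {N N' : LinearPeriodicNet}
    (h : PeriodicallyIsotopic N N') : Nonempty (N.structureGraph ≃g N'.structureGraph) := by
  obtain ⟨𝒩, a, f, -, rfl, -, -, hbij, -, -, hedge⟩ := h
  replace hbij := hbij 1
  replace hedge := hedge 1
  generalize 𝒩 1 = N' at *
  generalize f 1 = g at *
  obtain ⟨⟨hmaps, hinj, hsurj⟩, hnodes⟩ := hbij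
  have hnb {M : LinearPeriodicNet} {p : R3} (hp : p ∈ M.nodes) : p ∈ M.body := by
    rw [M.nodes_eq] at hp
    obtain ⟨e, he, hpe⟩ := hp
    exact Set.mem_biUnion he (mem_segmentOf_of_mem hpe)
  have hend {M : LinearPeriodicNet} {p q : R3} (h : s(p, q) ∈ M.edges) :
      p ∈ M.nodes ∧ q ∈ M.nodes := by
    rw [M.nodes_eq]
    exact ⟨⟨_, h, Sym2.mem_mk_left p q⟩, ⟨_, h, Sym2.mem_mk_right p q⟩⟩
  -- That every edge of the target is the image of an edge is not part of the definition. It follows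
  -- from surjectivity on bodies: the midpoint of a target edge lies on the image of some edge, and
  -- two distinct edges cannot share a point that is not an endpoint.
  have hpre (p' q' : R3) (h' : s(p', q') ∈ N'.edges) :
      ∃ p q, s(p, q) ∈ N.edges ∧ s(p', q') = s(g p, g q) := by
    have hx : midpoint ℝ p' q' ∈ segmentOf s(p', q') := midpoint_mem_segment p' q'
    obtain ⟨y, hy, hyx⟩ := hsurj (Set.mem_biUnion h' hx)
    obtain ⟨e, he, hye⟩ := Set.mem_iUnion₂.mp hy
    induction e with
    | _ p q =>
    refine ⟨p, q, he, ?_⟩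
    by_contra hne
    have hye' : y ∈ segment ℝ p q := hye
    rw [segment_eq_image_lineMap] at hye'
    obtain ⟨c, hc, rfl⟩ := hye'
    have hmem : midpoint ℝ p' q' ∈ segmentOf s(g p, g q) := by
      rw [← hyx, (hedge p q he).2 c hc]
      change _ ∈ segment ℝ (g p) (g q)
      rw [segment_eq_image_lineMap]
      exact ⟨c, hc, rfl⟩
    have hend' := (N'.essentially_disjoint _ h' _ (hedge p q he).1 hne _ ⟨hx, hmem⟩).1
    have hpq : p' ≠ q' := by
      rintro rfl
      exact N'.edges_nondegenerate _ h' rfl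
    rw [Sym2.mem_iff, midpoint_eq_left_iff, midpoint_eq_right_iff] at hend'
    rcases hend' with h | h <;> exact hpq h
  have hb : Function.Bijective (fun p : N.nodes => (⟨g p, hnodes p.2⟩ : N'.nodes)) := by
    constructor
    · intro p q hpq
      exact Subtype.ext (hinj (hnb p.2) (hnb q.2) (Subtype.ext_iff.mp hpq))
    · rintro ⟨p', hp'⟩
      have hp := hp'
      rw [N'.nodes_eq] at hp
      obtain ⟨_, he, q', rfl⟩ := hp
      obtain ⟨p, q, hpq, h⟩ := hpre p' q' he
      rcases Sym2.eq_iff.mp h with ⟨rfl, -⟩ | ⟨rfl, -⟩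
      · exact ⟨⟨p, (hend hpq).1⟩, rfl⟩
      · exact ⟨⟨q, (hend hpq).2⟩, rfl⟩
  refine ⟨⟨Equiv.ofBijective _ hb, ?_⟩⟩
  rintro ⟨p, hp⟩ ⟨q, hq⟩
  change s(g p, g q) ∈ N'.edges ↔ s(p, q) ∈ N.edges
  refine ⟨fun h => ?_, fun h => (hedge p q h).1⟩
  obtain ⟨r, s, hrs, heq⟩ := hpre _ _ h
  have hr := hnb (hend hrs).1
  have hs := hnb (hend hrs).2
  rcases Sym2.eq_iff.mp heq with ⟨h1, h2⟩ | ⟨h1, h2⟩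
  · rwa [hinj (hnb hp) hr h1, hinj (hnb hq) hs h2]
  · rwa [hinj (hnb hp) hs h1, hinj (hnb hq) hr h2, Sym2.eq_swap]

/-! ### Finite classification of the sets of edge vectors -/

/-- The selections of at most one member from each list. -/
def choices {α : Type*} : List (List α) → List (List α)
  | [] => [[]]
  | C :: Cs => (choices Cs).flatMap fun c => c :: C.map fun a => a :: c

/-- With `P` membership in the set of edge vectors and `Cs` the parity classes, this replaces an
arbitrary set by a member of a finite enumeration. -/
lemma exists_mem_choices {α : Type*} (P : α → Prop) (Cs : List (List α))
    (h : ∀ C ∈ Cs, ∀ u ∈ C, ∀ v ∈ C, P u → P v → u = v) :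
    ∃ c ∈ choices Cs, (∀ v ∈ c, v ∈ Cs.flatten ∧ P v) ∧ ∀ v ∈ Cs.flatten, P v → v ∈ c := by
  induction Cs with
  | nil => exact ⟨[], by simp [choices]⟩
  | cons C Cs ih =>
    obtain ⟨c, hc, h1, h2⟩ := ih fun C' hC' => h C' (List.mem_cons_of_mem _ hC')
    by_cases hP : ∃ u ∈ C, P u
    · obtain ⟨u, hu, hPu⟩ := hP
      refine ⟨u :: c, List.mem_flatMap.mpr ⟨c, hc, by simp [hu]⟩, ?_, ?_⟩
      · intro v hv
        rcases List.mem_cons.mp hv with rfl | hv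
        · simp [hu, hPu]
        · have := h1 v hv
          simp_all
      · intro v hv hPv
        rw [List.flatten_cons, List.mem_append] at hv
        rcases hv with hv | hv
        · rw [h C List.mem_cons_self v hv u hu hPv hPu]
          exact List.mem_cons_self
        · exact List.mem_cons_of_mem _ (h2 v hv hPv)
    · push Not at hP
      refine ⟨c, List.mem_flatMap.mpr ⟨c, hc, by simp⟩, ?_, ?_⟩
      · intro v hv
        have := h1 v hv
        simp_all
      · intro v hv hPv
        rw [List.flatten_cons, List.mem_append] at hv
        rcases hv with hv | hv
        · exact absurd hPv (hP v hv)
        · exact h2 v hv hPv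

/-- The nonzero vectors with coordinates of modulus at most 1, up to sign, sorted by their residues
modulo 2. -/
def parityClasses : List (List (Fin 3 → ℤ)) :=
  [[ax], [ay], [az], [fx, gx], [fy, gy], [fz, gz],
    [d, ![-1, 1, 1], ![1, -1, 1], ![1, 1, -1]]]

/-- The position of a pair `±v` in an enumeration of the vectors with coordinates of modulus at
most 1. -/
def pairCode (v : Fin 3 → ℤ) : ℕ := (v 0 + 3 * v 1 + 9 * v 2).natAbs

/-- The set of the codes of a list of vectors, as a bit vector. -/
def pairMask (w : List (Fin 3 → ℤ)) : ℕ := w.foldr (fun v m => m ||| 2 ^ pairCode v) 0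

/-- Balanced ternary expansions are unique, and the absolute value identifies a vector with its
negative. -/
lemma pairCode_eq_iff {u v : Fin 3 → ℤ} (hu : ∀ i, |u i| ≤ 1) (hv : ∀ i, |v i| ≤ 1) :
    pairCode u = pairCode v ↔ u = v ∨ u = -v := by
  have a0 := hu 0
  have a1 := hu 1
  have a2 := hu 2
  have b0 := hv 0
  have b1 := hv 1
  have b2 := hv 2
  rw [abs_le] at a0 a1 a2 b0 b1 b2
  have h1 : u = v ↔ u 0 = v 0 ∧ u 1 = v 1 ∧ u 2 = v 2 := by
    rw [funext_iff, Fin.forall_fin_succ, Fin.forall_fin_two]; rfl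
  have h2 : u = -v ↔ u 0 = -v 0 ∧ u 1 = -v 1 ∧ u 2 = -v 2 := by
    rw [funext_iff, Fin.forall_fin_succ, Fin.forall_fin_two]; rfl
  rw [h1, h2]
  simp only [pairCode]
  omega

/-- The bit at `pairCode u` records whether `u` or `-u` occurs. One inclusion suffices, since the
hypotheses are symmetric in the two lists. -/
lemma pairMask_eq {w w' : List (Fin 3 → ℤ)} (hw : ∀ v ∈ w, ∀ i, |v i| ≤ 1)
    (hw' : ∀ v ∈ w', ∀ i, |v i| ≤ 1) (h : pairMask w = pairMask w') (v : Fin 3 → ℤ)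
    (hv : v ∈ symmList w) : v ∈ symmList w' := by
  obtain ⟨u, hu, huv⟩ : ∃ u ∈ w, v = u ∨ v = -u := by
    rcases mem_symmList.mp hv with hv | hv
    · exact ⟨v, hv, Or.inl rfl⟩
    · exact ⟨-v, hv, Or.inr (neg_neg v).symm⟩
  have h1 : (pairMask w).testBit (pairCode u) = true :=
    (testBit_foldr_lor w _ _).mpr ⟨u, hu, Nat.testBit_two_pow_self⟩
  rw [h] at h1
  obtain ⟨u', hu', h2⟩ := (testBit_foldr_lor w' _ _).mp h1
  rw [Nat.testBit_two_pow, decide_eq_true_eq, pairCode_eq_iff (hw' u' hu') (hw u hu)] at h2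
  rw [mem_symmList]
  rcases huv with rfl | rfl <;> rcases h2 with rfl | rfl <;> simp_all

/-- The product of a matrix and a vector, in a form suited to evaluation. -/
def apply3 (Z : Matrix (Fin 3) (Fin 3) ℤ) (v : Fin 3 → ℤ) : Fin 3 → ℤ := fun i =>
  Z i 0 * v 0 + Z i 1 * v 1 + Z i 2 * v 2

lemma apply3_eq (Z : Matrix (Fin 3) (Fin 3) ℤ) (v : Fin 3 → ℤ) : apply3 Z v = Z.mulVec v := by
  funext i
  simp [apply3, Matrix.mulVec, dotProduct, Fin.sum_univ_three]

/-- The signed permutation `v ↦ (v i, s * v j, t * v k)`. -/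
def signedPerm (x : (Fin 3 × Fin 3 × Fin 3) × ℤ × ℤ) (v : Fin 3 → ℤ) : Fin 3 → ℤ :=
  ![v x.1.1, x.2.1 * v x.1.2.1, x.2.2 * v x.1.2.2]

/-- The matrix of `signedPerm x`. -/
def signedPermMatrix (x : (Fin 3 × Fin 3 × Fin 3) × ℤ × ℤ) : Matrix (Fin 3) (Fin 3) ℤ :=
  Matrix.of ![Pi.single x.1.1 1, Pi.single x.1.2.1 x.2.1, Pi.single x.1.2.2 x.2.2]

lemma signedPerm_eq (x : (Fin 3 × Fin 3 × Fin 3) × ℤ × ℤ) (v : Fin 3 → ℤ) :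
    signedPerm x v = (signedPermMatrix x).mulVec v := by
  funext i
  fin_cases i <;> simp [signedPerm, signedPermMatrix, Matrix.mulVec]

/-- The signed permutations, up to sign. -/
def signedPerms : List ((Fin 3 × Fin 3 × Fin 3) × ℤ × ℤ) :=
  [(0, 1, 2), (0, 2, 1), (1, 0, 2), (1, 2, 0), (2, 0, 1), (2, 1, 0)] ×ˢ ([1, -1] ×ˢ [1, -1])

/-- Matrices which, followed by signed permutations, carry the indicated model words to all
generating sets of small vectors. -/
def reducingMatrices : List (Matrix (Fin 3) (Fin 3) ℤ × List (Fin 19)) :=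
  [(!![1, 0, 0; 0, 1, 0; 0, 0, 1], [0, 1, 2, 3, 4, 5, 6, 7, 8, 9, 10, 11, 12, 13, 14, 15, 16, 17, 18]),
    (!![-1, 0, 0; -1, 1, 0; 0, 0, -1], [0, 1, 2, 3, 4, 6, 7, 8, 11, 13, 16]),
    (!![-1, 0, 1; -1, 1, 0; 0, -1, 0], [0, 2, 3, 6, 7, 11]),
    (!![-1, -1, 1; 0, -1, 0; 0, 0, -1], [0, 1, 2, 6]),
    (!![-1, 0, 1; 0, -1, 1; 0, 0, -1], [0, 2, 6, 11]),
    (!![-1, -1, 1; -1, 0, 0; -1, 0, 1], [0, 1, 2, 6]),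
    (!![-1, -1, 0; -1, -1, 1; -1, 0, 1], [0, 2, 6]),
    (!![-1, -1, 0; -1, 0, 0; -1, 1, -1], [0, 2]),
    (!![-1, 1, 0; -1, 1, 1; 0, -1, 0], [3, 7]),
    (!![-1, -1, 0; -1, 1, -1; 0, -1, 1], [0, 2]),
    (!![-1, -1, 0; -1, 0, 0; 0, 0, -1], [12]),
    (!![-1, 0, 0; -1, 0, 1; 0, -1, 0], [9]),
    (!![-1, -1, 0; -1, 0, -1; -1, 0, 0], [12]),
    (!![-1, 0, 0; -1, 1, 1; 0, -1, 0], [7]),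
    (!![-1, 1, 1; 0, -1, 0; 0, 0, -1], [7])]

/-- The pairs of a reducing matrix and the index of a model word. -/
def smallImages : List (Matrix (Fin 3) (Fin 3) ℤ × Fin 19) :=
  reducingMatrices.flatMap fun z => z.2.map fun i => (z.1, i)

/-- The masks of the small vector sets equivalent to model words, as a bit vector. -/
def coveredBits : ℕ :=
  smallImages.foldr (fun z B => B ||| signedPerms.foldr (fun x B => B |||
    2 ^ pairMask ((modelWord z.2).map fun v => signedPerm x (apply3 z.1 v))) 0) 0

/-- Linear forms modulo 2 and 3, with a coefficient 1. -/
def modForms : List (ℤ × ℤ × ℤ × ℤ) :=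
  [(2, 0, 0, 1), (2, 0, 1, 0), (2, 0, 1, 1), (2, 1, 0, 0), (2, 1, 0, 1), (2, 1, 1, 0), (2, 1, 1, 1),
    (3, 1, 1, 1), (3, 1, 1, -1), (3, 1, -1, 1), (3, 1, -1, -1)]

/-- Some nonzero linear form modulo 2 or 3 vanishes on the vectors of the list. -/
def isDegenerate (c : List (Fin 3 → ℤ)) : Bool :=
  modForms.any fun φ => c.all fun v =>
    (φ.2.1 * v 0 + φ.2.2.1 * v 1 + φ.2.2.2 * v 2) % φ.1 == 0

/-- The masks of the nondegenerate selections from the parity classes, as a bit vector. -/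
def nondegenerateBits : ℕ :=
  (choices parityClasses).foldr (fun c B => B ||| bif isDegenerate c then 0 else 2 ^ pairMask c) 0

-- This is the whole finite classification: among the `2³ * 3³ * 5 = 1080` selections, the mask of
-- each nondegenerate one is the mask of an image of a model word. Inclusion of sets of masks is a
-- single bitwise identity.
set_option maxRecDepth 100000 in
lemma nondegenerateBits_land_coveredBits :
    nondegenerateBits &&& coveredBits = nondegenerateBits := by
  decide +kernel

/-- The bound on the images is needed because masks determine vectors, up to sign, only inside the
box. -/
lemma smallImages_spec : ∀ z ∈ smallImages,
    (z.1.det = 1 ∨ z.1.det = -1) ∧ ∀ v ∈ modelWord z.2, ∀ i, |apply3 z.1 v i| ≤ 1 := by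
  simp only [Matrix.det_fin_three]
  decide +kernel

lemma signedPerms_spec : ∀ x ∈ signedPerms,
    ((signedPermMatrix x).det = 1 ∨ (signedPermMatrix x).det = -1) ∧ |x.2.1| = 1 ∧ |x.2.2| = 1 := by
  simp only [Matrix.det_fin_three]
  decide +kernel

lemma parityClasses_bound : ∀ v ∈ parityClasses.flatten, ∀ i, |v i| ≤ 1 := by
  decide +kernel

lemma parityClasses_spec : ∀ C ∈ parityClasses, ∀ u ∈ C, ∀ v ∈ C,
    (∀ i, (u i - v i) % 2 = 0) ∧ u ≠ -v := by
  decide +kernel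

lemma mem_parityClasses : ∀ x ∈ [-1, 0, 1], ∀ y ∈ [-1, 0, 1], ∀ z ∈ [-1, 0, 1],
    (![x, y, z] : Fin 3 → ℤ) = 0 ∨ (![x, y, z] : Fin 3 → ℤ) ∈ parityClasses.flatten ∨
      -(![x, y, z] : Fin 3 → ℤ) ∈ parityClasses.flatten := by
  decide +kernel

lemma modForms_spec : ∀ φ ∈ modForms,
    1 < φ.1 ∧ (φ.2.1 = 1 ∨ φ.2.2.1 = 1 ∨ φ.2.2.2 = 1) := by
  decide +kernel

/-- The bit of `pairMask c` is set in `nondegenerateBits`, hence in `coveredBits`. There it stems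
from a reducing matrix followed by a signed permutation, and `Q` is their product. -/
lemma exists_equiv_modelWord {c : List (Fin 3 → ℤ)} (hc : c ∈ choices parityClasses)
    (hb : ∀ v ∈ c, ∀ i, |v i| ≤ 1) (hd : isDegenerate c = false) :
    ∃ (i : Fin 19) (Q : Matrix (Fin 3) (Fin 3) ℤ), (Q.det = 1 ∨ Q.det = -1) ∧
      ∀ v, v ∈ symmList c ↔ v ∈ symmList ((modelWord i).map Q.mulVec) := by
  have h : nondegenerateBits.testBit (pairMask c) = true := by
    refine (testBit_foldr_lor _ _ _).mpr ⟨c, hc, ?_⟩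
    rw [hd, cond_false]
    exact Nat.testBit_two_pow_self
  rw [← nondegenerateBits_land_coveredBits, Nat.testBit_land, Bool.and_eq_true] at h
  obtain ⟨z, hz, h⟩ := (testBit_foldr_lor _ _ _).mp h.2
  obtain ⟨x, hx, h⟩ := (testBit_foldr_lor _ _ _).mp h
  rw [Nat.testBit_two_pow, decide_eq_true_eq] at h
  obtain ⟨hzd, hzb⟩ := smallImages_spec z hz
  obtain ⟨hxd, hx1, hx2⟩ := signedPerms_spec x hx
  have hQ : (fun v => signedPerm x (apply3 z.1 v)) = (signedPermMatrix x * z.1).mulVec := by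
    funext v
    rw [apply3_eq, signedPerm_eq, Matrix.mulVec_mulVec]
  have hb' : ∀ v ∈ (modelWord z.2).map fun v => signedPerm x (apply3 z.1 v), ∀ i, |v i| ≤ 1 := by
    intro v hv i
    obtain ⟨u, hu, rfl⟩ := List.mem_map.mp hv
    have := hzb u hu
    fin_cases i <;> simp [signedPerm, abs_mul, hx1, hx2, this]
  refine ⟨z.2, signedPermMatrix x * z.1, ?_, fun v => ?_⟩
  · rw [Matrix.det_mul]
    rcases hzd with h | h <;> rcases hxd with h' | h' <;> simp [h, h']
  · rw [← hQ]
    exact ⟨pairMask_eq hb hb' h.symm v, pairMask_eq hb' hb h v⟩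

/-- A symmetric generating set of integer vectors with coordinates of modulus at most 1, no two
of which are congruent modulo 2 except for sign, is equivalent to one of the model words. -/
lemma exists_modelWord_of_generating {W : Set (Fin 3 → ℤ)} (hbox : ∀ v ∈ W, ∀ i, |v i| ≤ 1)
    (hzero : 0 ∉ W) (hsymm : ∀ v ∈ W, -v ∈ W)
    (hpar : ∀ u ∈ W, ∀ v ∈ W, (∀ i, (u i - v i) % 2 = 0) → u = v ∨ u = -v)
    (hgen : ∀ H : AddSubgroup (Fin 3 → ℤ), W ⊆ H → H = ⊤) :
    ∃ (i : Fin 19) (Q : Matrix (Fin 3) (Fin 3) ℤ), (Q.det = 1 ∨ Q.det = -1) ∧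
      ∀ v, v ∈ W ↔ v ∈ symmList ((modelWord i).map Q.mulVec) := by
  obtain ⟨c, hc, h1, h2⟩ := exists_mem_choices (· ∈ W) parityClasses (by
    intro C hC u hu v hv hu' hv'
    obtain ⟨h1, h2⟩ := parityClasses_spec C hC u hu v hv
    exact (hpar u hu' v hv' h1).resolve_right h2)
  have hW (v : Fin 3 → ℤ) : v ∈ W ↔ v ∈ symmList c := by
    rw [mem_symmList]
    refine ⟨fun hv => ?_, fun h => ?_⟩
    · have hmem (i : Fin 3) : v i ∈ [-1, 0, 1] := by
        have := hbox v hv i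
        rw [abs_le] at this
        simp only [List.mem_cons, List.not_mem_nil, or_false]
        omega
      have he : ![v 0, v 1, v 2] = v := by
        funext i; fin_cases i <;> rfl
      have := mem_parityClasses (v 0) (hmem 0) (v 1) (hmem 1) (v 2) (hmem 2)
      rw [he] at this
      rcases this with rfl | h | h
      · exact absurd hv hzero
      · exact Or.inl (h2 v h hv)
      · exact Or.inr (h2 _ h (hsymm v hv))
    · rcases h with h | h
      · exact (h1 v h).2
      · simpa using hsymm _ (h1 _ h).2
  have hd : isDegenerate c = false := by
    by_contra hd
    rw [Bool.not_eq_false, isDegenerate, List.any_eq_true] at hd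
    obtain ⟨φ, hφ, hd⟩ := hd
    simp only [List.all_eq_true, beq_iff_eq] at hd
    obtain ⟨hp, h1⟩ := modForms_spec φ hφ
    -- The kernel of a degenerate form modulo 2 or 3 would contain the generating set `W`, yet it is
    -- a proper subgroup: the form takes the value 1 at a standard basis vector.
    let H : AddSubgroup (Fin 3 → ℤ) :=
      { carrier := {v | φ.1 ∣ φ.2.1 * v 0 + φ.2.2.1 * v 1 + φ.2.2.2 * v 2}
        zero_mem' := by simp
        add_mem' := by
          rintro u v ⟨x, hx⟩ ⟨y, hy⟩
          exact ⟨x + y, by rw [mul_add, ← hx, ← hy]; simp only [Pi.add_apply]; ring⟩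
        neg_mem' := by
          rintro u ⟨x, hx⟩
          exact ⟨-x, by rw [mul_neg, ← hx]; simp only [Pi.neg_apply]; ring⟩ }
    have hc' : ∀ v ∈ c, v ∈ H := fun v hv => Int.dvd_of_emod_eq_zero (hd v hv)
    have hH : H = ⊤ := by
      refine hgen H fun v hv => ?_
      rw [hW, mem_symmList] at hv
      rcases hv with hv | hv
      · exact hc' v hv
      · simpa using H.neg_mem (hc' _ hv)
    have hall (v : Fin 3 → ℤ) : φ.1 ∣ φ.2.1 * v 0 + φ.2.2.1 * v 1 + φ.2.2.2 * v 2 := by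
      change v ∈ H
      rw [hH]
      trivial
    have h3 : φ.1 ∣ 1 := by
      rcases h1 with h | h | h
      · simpa [h] using hall ![1, 0, 0]
      · simpa [h] using hall ![0, 1, 0]
      · simpa [h] using hall ![0, 0, 1]
    have := Int.le_of_dvd one_pos h3
    omega
  obtain ⟨i, Q, hQ, h⟩ := exists_equiv_modelWord hc (fun v hv => parityClasses_bound v (h1 v hv).1)
    hd
  exact ⟨i, Q, hQ, fun v => (hW v).trans (h v)⟩

/-! ### The model nets -/

lemma intPoint_add (k l : Fin 3 → ℤ) : intPoint (k + l) = intPoint k + intPoint l := by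
  funext i
  simp [intPoint]

/-- The standard basis of `ℝ³`. -/
def stdBasis : Fin 3 → R3 := fun i => Pi.single i 1

lemma latticeVector_stdBasis (k : Fin 3 → ℤ) : latticeVector stdBasis k = intPoint k := by
  funext i
  simp [latticeVector, stdBasis, intPoint, Finset.sum_apply, Pi.single_apply]

/-- An integer parameter in `[0, 1]` is 0 or 1, so proving that a point is an endpoint reduces to
proving its parameter integral. -/
lemma coords_of_mem_segmentOf {k u : Fin 3 → ℤ} {x : R3}
    (hx : x ∈ segmentOf s(intPoint k, intPoint (k + u))) :
    ∃ s : ℝ, 0 ≤ s ∧ s ≤ 1 ∧ (∀ i, x i = k i + s * u i) ∧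
      ((∃ n : ℤ, s = n) → x ∈ s(intPoint k, intPoint (k + u))) := by
  change x ∈ segment ℝ _ _ at hx
  rw [segment_eq_image'] at hx
  obtain ⟨s, ⟨h0, h1⟩, rfl⟩ := hx
  refine ⟨s, h0, h1, fun i => by simp [intPoint], ?_⟩
  rintro ⟨n, rfl⟩
  have h0' : 0 ≤ n := by exact_mod_cast h0
  have h1' : n ≤ 1 := by exact_mod_cast h1
  rw [Sym2.mem_iff]
  obtain rfl | rfl : n = 0 ∨ n = 1 := by omega
  · left; simp
  · right; simp

/-- A common point with parameters `s` and `t` gives `s u - t v = l - k`, an integer vector. If `u ≠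
v`, Cramer's rule for a minor equal to `±1`, its own inverse, makes `s` and `t` integers. If `u =
v`, a coordinate `±1` makes `s - t` an integer: 0 forces the edges to coincide, and `±1` puts the
point at endpoints. -/
lemma modelEdges_essentially_disjoint {w : List (Fin 3 → ℤ)} (hw : ∀ u ∈ w, ∃ i, u i ^ 2 = 1)
    (hw' : ∀ u ∈ w, ∀ v ∈ w, u ≠ v → ∃ i j, (u i * v j - u j * v i) ^ 2 = 1) :
    ∀ e ∈ modelEdges w, ∀ e' ∈ modelEdges w, e ≠ e' →
      ∀ x ∈ segmentOf e ∩ segmentOf e', x ∈ e ∧ x ∈ e' := by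
  rintro _ ⟨k, u, hu, rfl⟩ _ ⟨l, v, hv, rfl⟩ hne x ⟨hx, hx'⟩
  obtain ⟨s, hs0, hs1, hs, hs'⟩ := coords_of_mem_segmentOf hx
  obtain ⟨t, ht0, ht1, ht, ht'⟩ := coords_of_mem_segmentOf hx'
  have hst (i : Fin 3) : s * u i - t * v i = l i - k i := by
    linarith [hs i, ht i]
  by_cases huv : u = v
  · subst huv
    obtain ⟨i, hi⟩ := hw u hu
    have hi' : (u i : ℝ) ^ 2 = 1 := by exact_mod_cast hi
    have hd : s - t = ((l i - k i) * u i : ℤ) := by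
      push_cast
      linear_combination (u i : ℝ) * hst i - (s - t) * hi'
    generalize (l i - k i) * u i = n at hd
    have h1 : -1 ≤ n := by
      have : (-1 : ℝ) ≤ n := by linarith
      exact_mod_cast this
    have h2 : n ≤ 1 := by
      have : (n : ℝ) ≤ 1 := by linarith
      exact_mod_cast this
    obtain rfl | rfl | rfl : n = -1 ∨ n = 0 ∨ n = 1 := by omega
    · exact ⟨hs' ⟨0, by push_cast at *; linarith⟩, ht' ⟨1, by push_cast at *; linarith⟩⟩
    · refine absurd ?_ hne
      have : k = l := by
        funext j
        have := hst j
        rw [← sub_mul, hd] at this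
        push_cast at this
        have : (k j : ℝ) = l j := by linarith
        exact_mod_cast this
      rw [this]
    · exact ⟨hs' ⟨1, by push_cast at *; linarith⟩, ht' ⟨0, by push_cast at *; linarith⟩⟩
  · obtain ⟨i, j, hij⟩ := hw' u hu v hv huv
    have hij' : ((u i : ℝ) * v j - u j * v i) ^ 2 = 1 := by exact_mod_cast hij
    refine ⟨hs' ⟨(u i * v j - u j * v i) * ((l i - k i) * v j - (l j - k j) * v i), ?_⟩,
      ht' ⟨(u i * v j - u j * v i) * ((l i - k i) * u j - (l j - k j) * u i), ?_⟩⟩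
    · push_cast
      linear_combination (-s) * hij' + ((u i : ℝ) * v j - u j * v i) *
        (v j * hst i - v i * hst j)
    · push_cast
      linear_combination (-t) * hij' + ((u i : ℝ) * v j - u j * v i) *
        (u j * hst i - u i * hst j)

lemma modelWord_primitive (i : Fin 19) : ∀ u ∈ modelWord i, ∃ j, u j ^ 2 = 1 := by
  revert i
  decide +kernel

lemma modelWord_minors (i : Fin 19) : ∀ u ∈ modelWord i, ∀ v ∈ modelWord i, u ≠ v →
    ∃ j k, (u j * v k - u k * v j) ^ 2 = 1 := by
  revert i
  decide +kernel

/-- This yields connectedness of the model nets; the vector 0 is admitted so that shorter sums count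
as well. -/
lemma modelWord_generates (i : Fin 19) : ∀ j, ∃ a ∈ 0 :: symmList (modelWord i),
    ∃ b ∈ 0 :: symmList (modelWord i), ∃ c ∈ 0 :: symmList (modelWord i),
      a + b + c = Pi.single j 1 := by
  revert i
  decide +kernel

lemma translate_modelEdges {w : List (Fin 3 → ℤ)} (k : Fin 3 → ℤ) {e : Sym2 R3}
    (he : e ∈ modelEdges w) : translateEdge (intPoint k) e ∈ modelEdges w := by
  obtain ⟨l, v, hv, rfl⟩ := he
  exact ⟨l + k, v, hv, by
    rw [translateEdge, Sym2.map_mk, ← intPoint_add, ← intPoint_add, add_right_comm]⟩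

lemma isPeriodBasis_stdBasis (w : List (Fin 3 → ℤ)) :
    IsPeriodBasis (Set.range intPoint) (modelEdges w) stdBasis := by
  refine ⟨?_, ?_, ?_⟩
  · rw [linearIndependent_iff_det_ne_zero]
    have : Matrix.of stdBasis = 1 := by
      ext i j
      simp [stdBasis, Matrix.one_apply, Pi.single_apply, eq_comm]
    simp [this]
  · rintro _ ⟨k, rfl⟩ _ ⟨l, rfl⟩
    exact ⟨l + k, by rw [latticeVector_stdBasis, intPoint_add]⟩
  · rintro _ ⟨k, rfl⟩ e he
    rw [latticeVector_stdBasis]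
    exact translate_modelEdges k he

/-- The model net with the edge word `modelWord i`. -/
def modelNet (i : Fin 19) : LinearPeriodicNet where
  nodes := Set.range intPoint
  edges := modelEdges (modelWord i)
  edges_countable := by
    have h : modelEdges (modelWord i) ⊆ Set.range fun x : (Fin 3 → ℤ) × (Fin 3 → ℤ) =>
        s(intPoint x.1, intPoint (x.1 + x.2)) := by
      rintro _ ⟨k, v, -, rfl⟩
      exact ⟨(k, v), rfl⟩
    exact (Set.countable_range _).mono h
  edges_nondegenerate := by
    rintro _ ⟨k, v, hv, rfl⟩ h
    rw [Sym2.mk_isDiag_iff, intPoint_injective.eq_iff, left_eq_add] at h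
    obtain ⟨j, hj⟩ := modelWord_primitive i v hv
    simp [h] at hj
  essentially_disjoint :=
    modelEdges_essentially_disjoint (modelWord_primitive i) (modelWord_minors i)
  nodes_eq := by
    ext p
    constructor
    · rintro ⟨k, rfl⟩
      obtain ⟨v, hv⟩ : ∃ v, v ∈ modelWord i := by
        have : ∀ i, ∃ v, v ∈ modelWord i := by
          intro i
          fin_cases i <;> exact ⟨_, List.mem_cons_self⟩
        exact this i
      exact ⟨_, ⟨k, v, hv, rfl⟩, Sym2.mem_mk_left _ _⟩
    · rintro ⟨_, ⟨k, v, hv, rfl⟩, hp⟩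
      rcases Sym2.mem_iff.mp hp with rfl | rfl
      · exact ⟨_, rfl⟩
      · exact ⟨_, rfl⟩
  periodic := by
    refine ⟨stdBasis, isPeriodBasis_stdBasis _, ⟨{0}, Set.finite_singleton _, ?_⟩,
      ⟨(fun v => s(intPoint 0, intPoint v)) '' {v | v ∈ modelWord i},
        (List.finite_toSet _).image _, ?_⟩⟩
    · rintro _ ⟨k, rfl⟩
      exact ⟨0, rfl, _, ⟨k, rfl⟩, by rw [latticeVector_stdBasis, zero_add]⟩
    · rintro _ ⟨k, v, hv, rfl⟩
      refine ⟨_, ⟨v, hv, rfl⟩, _, ⟨k, rfl⟩, ?_⟩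
      rw [latticeVector_stdBasis, translateEdge, Sym2.map_mk, ← intPoint_add, ← intPoint_add,
        zero_add, add_comm v]

/-! ### Nets with one class of nodes and their adjacency depth -/

lemma latticeVector_add (a : Fin 3 → R3) (k l : Fin 3 → ℤ) :
    latticeVector a (k + l) = latticeVector a k + latticeVector a l := by
  simp only [latticeVector, Pi.add_apply, add_smul, Finset.sum_add_distrib]

lemma latticeVector_zero (a : Fin 3 → R3) : latticeVector a 0 = 0 := by
  simp [latticeVector]

lemma latticeVector_eq_mulVec (a : Fin 3 → R3) (k : Fin 3 → ℤ) :
    latticeVector a k = (Matrix.of a).transpose.mulVec (intPoint k) := by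
  funext i
  simp [latticeVector, Matrix.mulVec, dotProduct, intPoint, Finset.sum_apply, mul_comm]

namespace LinearPeriodicNet

/-- In a net with a single vertex quotient graph, the nodes are the translates of any one node
by the translations of any primitive basis. -/
lemma HasSingleVertexQuotient.nodes_eq_translates {N : LinearPeriodicNet}
    (h : N.HasSingleVertexQuotient) {a : Fin 3 → R3} (ha : N.IsPrimitiveBasis a) {v p : R3}
    (hv : v ∈ N.nodes) (hp : p ∈ N.nodes) : ∃ k, p = v + latticeVector a k := by
  obtain ⟨b, o, hb, hF, hrep⟩ := h
  have hrep' : ∀ q ∈ N.nodes, ∃ x ∈ translationLattice b, q = o + x := by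
    intro q hq
    obtain ⟨_, ⟨rfl, k, hk⟩, -⟩ := hrep q hq
    exact ⟨_, ⟨k, rfl⟩, hk⟩
  -- Every period moves the node `o` to another node, hence lies in the lattice of `b`. That lattice
  -- thus contains the one of `a`, and primitivity of `a` makes them equal.
  have hsub : translationLattice a ⊆ translationLattice b := by
    intro x hx
    obtain ⟨y, hy, h⟩ := hrep' _ (ha.1.2.1 x hx o (hF rfl))
    rwa [add_left_cancel h]
  have hsup : translationLattice b ⊆ translationLattice a := by
    by_contra hne
    exact ha.2 b hb.1 ⟨hsub, hne⟩
  obtain ⟨x, ⟨k, rfl⟩, rfl⟩ := hrep' v hv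
  obtain ⟨y, ⟨l, rfl⟩, rfl⟩ := hrep' p hp
  obtain ⟨m, hm⟩ := hsup ⟨l - k, rfl⟩
  refine ⟨m, ?_⟩
  rw [hm, add_assoc, ← latticeVector_add]
  simp

lemma one_le_labelModulus {m : Fin 3 → ℤ} (hm : m ≠ 0) : 1 ≤ labelModulus m := by
  obtain ⟨i, hi⟩ := Function.ne_iff.mp hm
  exact (Int.natAbs_pos.mpr hi).trans_le
    (Finset.le_sup (f := fun i => (m i).natAbs) (Finset.mem_univ i))

lemma labelModulus_le_one_iff {m : Fin 3 → ℤ} : labelModulus m ≤ 1 ↔ ∀ i, |m i| ≤ 1 := by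
  simp only [labelModulus, Finset.sup_le_iff, Finset.mem_univ, true_imp_iff, abs_le]
  exact forall_congr' fun i => by omega

lemma IsNodeMotif.nonempty {N : LinearPeriodicNet} {a : Fin 3 → R3} {F : Set R3}
    (hF : N.IsNodeMotif a F) {p : R3} (hp : p ∈ N.nodes) : ∃ v, v ∈ F := by
  obtain ⟨v, ⟨hv, -⟩, -⟩ := hF.2 p hp
  exact ⟨v, hv⟩

/-- For every primitive basis, an edge at a motif node joins it to one of its own translates, and
nondegeneracy makes the label nonzero. -/
lemma one_le_adjacencyDepth {N : LinearPeriodicNet} (h : N.HasSingleVertexQuotient) :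
    1 ≤ N.adjacencyDepth := by
  refine le_iInf₂ fun a ha => le_iInf₂ fun F hF => ?_
  obtain ⟨b, o, hb, ho⟩ := h
  have h : N.HasSingleVertexQuotient := ⟨b, o, hb, ho⟩
  obtain ⟨v, hv⟩ := hF.nonempty (ho.1 rfl)
  have hvn := hF.1 hv
  have hvn' := hvn
  rw [N.nodes_eq] at hvn'
  obtain ⟨_, he, q, rfl⟩ := hvn'
  have hq : q ∈ N.nodes := by
    rw [N.nodes_eq]
    exact ⟨_, he, Sym2.mem_mk_right v q⟩
  obtain ⟨k, rfl⟩ := h.nodes_eq_translates ha hvn hq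
  have hk : 0 - k ≠ 0 := by
    rw [zero_sub, neg_ne_zero]
    rintro rfl
    refine N.edges_nondegenerate _ he ?_
    rw [latticeVector_zero, add_zero, Sym2.mk_isDiag_iff]
  have hmem : (v, v, 0 - k) ∈ N.labelledQuotientEdges a F :=
    ⟨hv, hv, 0, k, by simpa [latticeVector_zero] using he, rfl⟩
  refine le_trans ?_ (le_iSup₂ (f := fun x (_ : x ∈ N.labelledQuotientEdges a F) =>
    (labelModulus x.2.2 : ℕ∞)) _ hmem)
  exact_mod_cast one_le_labelModulus hk

end LinearPeriodicNet

open LinearPeriodicNet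

/-- As 0 is a node, every period is itself a node, hence an integer point. -/
lemma isPrimitiveBasis_modelNet (i : Fin 19) : (modelNet i).IsPrimitiveBasis stdBasis := by
  refine ⟨isPeriodBasis_stdBasis _, fun b hb hlt => hlt.2 fun x hx => ?_⟩
  have h0 : (0 : R3) ∈ (modelNet i).nodes := ⟨0, by funext i; simp [intPoint]⟩
  obtain ⟨k, hk⟩ : 0 + x ∈ (modelNet i).nodes := hb.2.1 x hx 0 h0
  exact ⟨k, by rw [latticeVector_stdBasis, hk, zero_add]⟩

lemma isNodeMotif_modelNet (i : Fin 19) : (modelNet i).IsNodeMotif stdBasis {0} := by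
  constructor
  · rintro _ rfl
    exact ⟨0, by funext i; simp [intPoint]⟩
  · rintro _ ⟨k, rfl⟩
    exact ⟨0, ⟨rfl, k, by rw [latticeVector_stdBasis, zero_add]⟩, fun v hv => hv.1⟩

lemma hasSingleVertexQuotient_modelNet (i : Fin 19) : (modelNet i).HasSingleVertexQuotient :=
  ⟨_, _, isPrimitiveBasis_modelNet i, isNodeMotif_modelNet i⟩

lemma adjacencyDepth_modelNet (i : Fin 19) : (modelNet i).adjacencyDepth = 1 := by
  refine le_antisymm ?_ (one_le_adjacencyDepth (hasSingleVertexQuotient_modelNet i))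
  refine (iInf₂_le _ (isPrimitiveBasis_modelNet i)).trans
    ((iInf₂_le _ (isNodeMotif_modelNet i)).trans (iSup₂_le ?_))
  rintro ⟨p, q, m⟩ ⟨hp, hq, k, l, he, hm⟩
  obtain rfl : p = 0 := hp
  obtain rfl : q = 0 := hq
  obtain rfl : m = k - l := hm
  rw [zero_add, zero_add, latticeVector_stdBasis, latticeVector_stdBasis] at he
  have h := modelWord_bound i _ (intPoint_mem_modelEdges.mp he)
  have : labelModulus (k - l) ≤ 1 := by
    rw [labelModulus_le_one_iff]
    intro j
    have := h j
    rwa [Pi.sub_apply, abs_sub_comm] at this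
  exact_mod_cast this

lemma isConnected_modelNet (i : Fin 19) : (modelNet i).IsConnected := by
  let P (k : Fin 3 → ℤ) : (modelNet i).nodes := ⟨intPoint k, k, rfl⟩
  have hstep : ∀ s ∈ 0 :: symmList (modelWord i), ∀ k,
      (modelNet i).structureGraph.Reachable (P k) (P (k + s)) := by
    intro s hs k
    rcases List.mem_cons.mp hs with rfl | hs
    · rw [add_zero]
    · refine SimpleGraph.Adj.reachable ?_
      change s(intPoint k, intPoint (k + s)) ∈ modelEdges (modelWord i)
      rw [intPoint_mem_modelEdges]
      simpa using hs
  -- The vectors by which every node can be displaced within its component form a subgroup; it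
  -- contains the edge vectors and therefore the standard basis.
  let H : AddSubgroup (Fin 3 → ℤ) :=
    { carrier := {m | ∀ k, (modelNet i).structureGraph.Reachable (P k) (P (k + m))}
      zero_mem' := fun k => by rw [add_zero]
      add_mem' := fun {u v} hu hv k => by
        rw [← add_assoc]
        exact (hu k).trans (hv (k + u))
      neg_mem' := fun {u} hu k => by
        have := hu (k + -u)
        rw [neg_add_cancel_right] at this
        exact this.symm }
  have hH (m : Fin 3 → ℤ) : m ∈ H := by
    rw [← Finset.univ_sum_single m]
    refine H.sum_mem fun j _ => ?_
    obtain ⟨a, ha, b, hb, c, hc, h⟩ := modelWord_generates i j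
    have h1 : Pi.single j 1 ∈ H := by
      rw [← h]
      exact H.add_mem (H.add_mem (hstep a ha) (hstep b hb)) (hstep c hc)
    have := H.zsmul_mem h1 (m j)
    rwa [← Pi.single_smul, smul_eq_mul, mul_one] at this
  have : Nonempty (modelNet i).nodes := ⟨P 0⟩
  refine SimpleGraph.Connected.mk ?_
  rintro ⟨_, k, rfl⟩ ⟨_, l, rfl⟩
  have := hH (l - k) k
  rwa [add_sub_cancel] at this

/-! ### Reduction of a net to a model -/

lemma midpoint_mem_segmentOf (p q : R3) : midpoint ℝ p q ∈ segmentOf s(p, q) :=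
  midpoint_mem_segment p q

lemma latticeVector_injective {a : Fin 3 → R3} (ha : LinearIndependent ℝ a) :
    Function.Injective (latticeVector a) := by
  intro k l h
  rw [latticeVector_eq_mulVec, latticeVector_eq_mulVec] at h
  refine intPoint_injective (Matrix.mulVec_injective_iff_isUnit.mpr ?_ h)
  rw [Matrix.isUnit_iff_isUnit_det, Matrix.det_transpose, isUnit_iff_ne_zero]
  exact (linearIndependent_iff_det_ne_zero a).mp ha

/-- This permits replacing `Q` by `-Q`, of opposite determinant, to correct the orientation. -/
lemma mem_symmList_map_neg {w : List (Fin 3 → ℤ)} {Q : Matrix (Fin 3) (Fin 3) ℤ}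
    {v : Fin 3 → ℤ} : v ∈ symmList (w.map (-Q).mulVec) ↔ v ∈ symmList (w.map Q.mulVec) := by
  rw [mem_symmList, mem_symmList, or_comm]
  simp only [List.mem_map, Matrix.neg_mulVec, neg_eq_iff_eq_neg, neg_neg]

lemma mem_symmList_map_mulVec {w : List (Fin 3 → ℤ)} {Q : Matrix (Fin 3) (Fin 3) ℤ}
    (hQ : Function.Injective Q.mulVec) {v : Fin 3 → ℤ} :
    Q.mulVec v ∈ symmList (w.map Q.mulVec) ↔ v ∈ symmList w := by
  rw [mem_symmList, mem_symmList, ← Matrix.mulVec_neg, List.mem_map_of_injective hQ,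
    List.mem_map_of_injective hQ]

lemma edge_iff_of_periodBasis {N : LinearPeriodicNet} {a : Fin 3 → R3}
    (ha : N.IsPeriodicityBasis a) (v : R3) (k l : Fin 3 → ℤ) :
    s(v + latticeVector a k, v + latticeVector a l) ∈ N.edges ↔
      s(v, v + latticeVector a (l - k)) ∈ N.edges := by
  constructor
  · intro h
    have := ha.2.2 _ ⟨-k, rfl⟩ _ h
    rwa [translateEdge, Sym2.map_mk, add_assoc, add_assoc, ← latticeVector_add,
      ← latticeVector_add, add_neg_cancel, latticeVector_zero, add_zero, ← sub_eq_add_neg] at this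
  · intro h
    have := ha.2.2 _ ⟨k, rfl⟩ _ h
    rwa [translateEdge, Sym2.map_mk, add_assoc, ← latticeVector_add, sub_add_cancel] at this

/-- Edges whose difference vectors are congruent modulo 2 have translates with a common midpoint. -/
lemma eq_or_eq_neg_of_congr {N : LinearPeriodicNet} {a : Fin 3 → R3}
    (ha : N.IsPeriodicityBasis a) {v : R3} {m m' : Fin 3 → ℤ}
    (hm : s(v, v + latticeVector a m) ∈ N.edges) (hm' : s(v, v + latticeVector a m') ∈ N.edges)
    (h : ∀ i, (m i - m' i) % 2 = 0) : m = m' ∨ m = -m' := by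
  -- Writing `m = 2k + m'`, the edge with vector `m'` translated by `k` has the same midpoint as the
  -- edge with vector `m`. The two edges must coincide, with equal or opposite directions.
  obtain ⟨k, hk⟩ : ∃ k : Fin 3 → ℤ, m = k + k + m' :=
    ⟨fun i => (m i - m' i) / 2, by
      funext i
      have := h i
      simp only [Pi.add_apply]
      omega⟩
  have hinj := latticeVector_injective ha.1
  have he : s(v + latticeVector a k, v + latticeVector a (k + m')) ∈ N.edges := by
    rw [edge_iff_of_periodBasis ha]
    simpa using hm'
  have hmid : midpoint ℝ v (v + latticeVector a m) =
      midpoint ℝ (v + latticeVector a k) (v + latticeVector a (k + m')) := by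
    rw [midpoint_eq_midpoint_iff_vsub_eq_vsub, hk, latticeVector_add, latticeVector_add,
      latticeVector_add]
    simp only [vsub_eq_sub]
    abel
  by_cases hne : s(v, v + latticeVector a m) =
      s(v + latticeVector a k, v + latticeVector a (k + m'))
  · rcases Sym2.eq_iff.mp hne with ⟨h1, -⟩ | ⟨h1, -⟩
    · left
      rw [left_eq_add, ← latticeVector_zero a, hinj.eq_iff] at h1
      simpa [h1] using hk
    · right
      rw [left_eq_add, ← latticeVector_zero a, hinj.eq_iff] at h1
      rw [hk, add_assoc, h1, add_zero, eq_neg_of_add_eq_zero_left h1]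
  · have hx := (N.essentially_disjoint _ hm _ he hne _
      ⟨midpoint_mem_segmentOf _ _, hmid ▸ midpoint_mem_segmentOf _ _⟩).1
    have hpq : v ≠ v + latticeVector a m := fun h => N.edges_nondegenerate _ hm
      (Sym2.mk_isDiag_iff.mpr h)
    rw [Sym2.mem_iff, midpoint_eq_left_iff, midpoint_eq_right_iff] at hx
    rcases hx with h | h <;> exact absurd h hpq

/-- Along a walk from `v` each edge adds an element of `H`, so all nodes lie in the translates of
`v` by `H`. Every lattice translate of `v` is a node. -/
lemma eq_top_of_isConnected {N : LinearPeriodicNet} (hc : N.IsConnected) {a : Fin 3 → R3}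
    (ha : N.IsPeriodicityBasis a) {v : R3} (hv : v ∈ N.nodes)
    (hall : ∀ p ∈ N.nodes, ∃ k, p = v + latticeVector a k) {H : AddSubgroup (Fin 3 → ℤ)}
    (hH : {m | s(v, v + latticeVector a m) ∈ N.edges} ⊆ (H : Set (Fin 3 → ℤ))) : H = ⊤ := by
  have key (p : N.nodes) : ∃ k ∈ H, p.1 = v + latticeVector a k := by
    have hr := (SimpleGraph.reachable_iff_reflTransGen _ _).mp (hc.preconnected ⟨v, hv⟩ p)
    induction hr with
    | refl => exact ⟨0, H.zero_mem, by rw [latticeVector_zero, add_zero]⟩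
    | @tail p q _ hpq ih =>
      obtain ⟨k, hk, hkp⟩ := ih
      obtain ⟨l, hl⟩ := hall q.1 q.2
      change s(p.1, q.1) ∈ N.edges at hpq
      rw [hkp, hl, edge_iff_of_periodBasis ha] at hpq
      exact ⟨l, by simpa using H.add_mem (hH hpq) hk, hl⟩
  rw [AddSubgroup.eq_top_iff']
  intro k
  obtain ⟨l, hl, h⟩ := key ⟨_, ha.2.1 _ ⟨k, rfl⟩ v hv⟩
  rwa [latticeVector_injective ha.1 (add_left_cancel h)]

/-- The edges of a connected net of adjacency depth 1 with a single vertex quotient graph are given,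
in terms of a suitable periodicity basis, by a unimodular image of a model word. -/
lemma exists_basis_modelWord {N : LinearPeriodicNet} (hc : N.IsConnected)
    (hd : N.adjacencyDepth = 1) (hs : N.HasSingleVertexQuotient) :
    ∃ (a : Fin 3 → R3) (v : R3) (i : Fin 19) (Q : Matrix (Fin 3) (Fin 3) ℤ),
      N.IsPeriodicityBasis a ∧ v ∈ N.nodes ∧ (∀ p ∈ N.nodes, ∃ k, p = v + latticeVector a k) ∧
      (Q.det = 1 ∨ Q.det = -1) ∧
      ∀ m, s(v, v + latticeVector a m) ∈ N.edges ↔ m ∈ symmList ((modelWord i).map Q.mulVec) := by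
  -- The strict inequality below 2 extracts an actual basis and motif from the infimum, with depth
  -- at most 1.
  have hlt : N.adjacencyDepth < 2 := by rw [hd]; norm_num
  simp only [adjacencyDepth, iInf_lt_iff] at hlt
  obtain ⟨a, ha, F, hF, hlt⟩ := hlt
  have hle : N.quotientDepth a F ≤ 1 := ENat.lt_add_one_iff (by simp) |>.mp (by
    rwa [one_add_one_eq_two])
  have hap := ha.1
  obtain ⟨p⟩ := hc.nonempty
  obtain ⟨v, hvF⟩ := hF.nonempty p.2
  have hv := hF.1 hvF
  have hall (p : R3) (hp : p ∈ N.nodes) : ∃ k, p = v + latticeVector a k :=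
    hs.nodes_eq_translates ha hv hp
  have hbox (m : Fin 3 → ℤ) (hm : s(v, v + latticeVector a m) ∈ N.edges) (i : Fin 3) :
      |m i| ≤ 1 := by
    have hmem : (v, v, 0 - m) ∈ N.labelledQuotientEdges a F :=
      ⟨hvF, hvF, 0, m, by simpa [latticeVector_zero] using hm, rfl⟩
    have h1 : (labelModulus (0 - m) : ℕ∞) ≤ 1 := (le_iSup₂
      (f := fun x (_ : x ∈ N.labelledQuotientEdges a F) => (labelModulus x.2.2 : ℕ∞)) _
      hmem).trans hle
    have h2 := labelModulus_le_one_iff.mp (by exact_mod_cast h1) i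
    simpa using h2
  have hzero : (0 : Fin 3 → ℤ) ∉ {m | s(v, v + latticeVector a m) ∈ N.edges} := by
    intro h
    refine N.edges_nondegenerate _ h ?_
    rw [latticeVector_zero, add_zero, Sym2.mk_isDiag_iff]
  have hsymm (m : Fin 3 → ℤ) (hm : s(v, v + latticeVector a m) ∈ N.edges) :
      s(v, v + latticeVector a (-m)) ∈ N.edges := by
    have := (edge_iff_of_periodBasis hap v m 0).mp
      (by rwa [latticeVector_zero, add_zero, Sym2.eq_swap])
    rwa [zero_sub] at this
  obtain ⟨i, Q, hQ, hW⟩ := exists_modelWord_of_generating hbox hzero hsymm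
    (fun m hm m' hm' => eq_or_eq_neg_of_congr hap hm hm')
    (fun H hH => eq_top_of_isConnected hc hap hv hall hH)
  exact ⟨a, v, i, Q, hap, hv, hall, hQ, hW⟩

/-- The affine map sends the integer point `k` to `v` plus the lattice vector of `Q k`. Since `Q`
permutes `ℤ³`, nodes correspond to nodes, and `hW` matches the edges. -/
lemma eq_affineImage_of_basis {N : LinearPeriodicNet} {a : Fin 3 → R3} {v : R3} {i : Fin 19}
    {Q : Matrix (Fin 3) (Fin 3) ℤ} (hap : N.IsPeriodicityBasis a) (hv : v ∈ N.nodes)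
    (hall : ∀ p ∈ N.nodes, ∃ k, p = v + latticeVector a k) (hQ : Q.det = 1 ∨ Q.det = -1)
    (hW : ∀ m, s(v, v + latticeVector a m) ∈ N.edges ↔
      m ∈ symmList ((modelWord i).map Q.mulVec))
    (hA : ((Matrix.of a).transpose * Q.map (Int.cast : ℤ → ℝ)).det ≠ 0) :
    N = (modelNet i).affineImage _ v hA := by
  have hunit : IsUnit Q := by
    rw [Matrix.isUnit_iff_isUnit_det]
    rcases hQ with h | h <;> simp [h]
  have hinj : Function.Injective Q.mulVec :=
    Matrix.mulVec_injective_of_isUnit hunit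
  have hsurj : Function.Surjective Q.mulVec := Matrix.mulVec_surjective_iff_isUnit.mpr hunit
  have hpt (k : Fin 3 → ℤ) : affMap ((Matrix.of a).transpose * Q.map (Int.cast : ℤ → ℝ)) v
      (intPoint k) = v + latticeVector a (Q.mulVec k) := by
    rw [affMap_apply, add_comm, latticeVector_eq_mulVec, ← Matrix.mulVec_mulVec]
    congr 2
    funext j
    simp [Matrix.mulVec, dotProduct, intPoint]
  have hedge (k l : Fin 3 → ℤ) : s(v + latticeVector a (Q.mulVec k),
      v + latticeVector a (Q.mulVec l)) ∈ N.edges ↔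
      s(intPoint k, intPoint l) ∈ modelEdges (modelWord i) := by
    rw [edge_iff_of_periodBasis hap, hW, intPoint_mem_modelEdges, ← Matrix.mulVec_sub]
    exact mem_symmList_map_mulVec hinj
  have hnode (p : R3) (hp : p ∈ N.nodes) : ∃ k, p = v + latticeVector a (Q.mulVec k) := by
    obtain ⟨k, rfl⟩ := hall p hp
    obtain ⟨k, rfl⟩ := hsurj k
    exact ⟨k, rfl⟩
  refine ext_nodes_edges ?_ ?_
  · ext p
    constructor
    · intro hp
      obtain ⟨k, rfl⟩ := hnode p hp
      exact ⟨_, ⟨k, rfl⟩, hpt k⟩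
    · rintro ⟨_, ⟨k, rfl⟩, rfl⟩
      rw [hpt]
      exact hap.2.1 _ ⟨_, rfl⟩ v hv
  · ext e
    constructor
    · intro he
      induction e with
      | _ p q =>
      obtain ⟨k, rfl⟩ := hnode p (by rw [N.nodes_eq]; exact ⟨_, he, Sym2.mem_mk_left _ _⟩)
      obtain ⟨l, rfl⟩ := hnode q (by rw [N.nodes_eq]; exact ⟨_, he, Sym2.mem_mk_right _ _⟩)
      exact ⟨_, (hedge k l).mp he, by rw [Sym2.map_mk, hpt, hpt]⟩
    · rintro ⟨_, ⟨k, u, hu, rfl⟩, rfl⟩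
      rw [Sym2.map_mk, hpt, hpt, hedge]
      exact ⟨k, u, hu, rfl⟩

/-- Every connected net of adjacency depth 1 with a single vertex quotient graph is the image of a
model net under an orientation preserving affine map. -/
lemma exists_eq_affineImage_modelNet {N : LinearPeriodicNet} (hc : N.IsConnected)
    (hd : N.adjacencyDepth = 1) (hs : N.HasSingleVertexQuotient) :
    ∃ (i : Fin 19) (A : Matrix (Fin 3) (Fin 3) ℝ) (v : R3) (hA : 0 < A.det),
      N = (modelNet i).affineImage A v hA.ne' := by
  obtain ⟨a, v, i, Q, hap, hv, hall, hQ, hW⟩ := exists_basis_modelWord hc hd hs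
  have hdet (Q : Matrix (Fin 3) (Fin 3) ℤ) :
      ((Matrix.of a).transpose * Q.map (Int.cast : ℤ → ℝ)).det = (Matrix.of a).det * Q.det := by
    rw [Matrix.det_mul, Matrix.det_transpose, Int.cast_det]
  -- If the orientation is wrong, `-Q` serves instead of `Q`: its determinant has the other sign in
  -- dimension 3, and the edge vectors are symmetric.
  rcases lt_or_ge 0 ((Matrix.of a).det * (Q.det : ℝ)) with hp | hp
  · rw [← hdet] at hp
    exact ⟨i, _, v, hp, eq_affineImage_of_basis hap hv hall hQ hW hp.ne'⟩
  · have hneg : (-Q).det = -Q.det := by simp [Matrix.det_neg]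
    have hQ0 : (Q.det : ℝ) ≠ 0 := by rcases hQ with h | h <;> simp [h]
    have hne := mul_ne_zero ((linearIndependent_iff_det_ne_zero a).mp hap.1) hQ0
    have hp' : 0 < (Matrix.of a).det * ((-Q).det : ℝ) := by
      rw [hneg, Int.cast_neg, mul_neg, neg_pos]
      exact lt_of_le_of_ne hp hne
    rw [← hdet] at hp'
    refine ⟨i, _, v, hp', eq_affineImage_of_basis hap hv hall ?_
      (fun m => (hW m).trans mem_symmList_map_neg.symm) hp'.ne'⟩
    rw [hneg]
    rcases hQ with h | h <;> simp [h]

lemma orientedlyAffinelyEquivalent_of_eq_affineImage {N M : LinearPeriodicNet}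
    {A : Matrix (Fin 3) (Fin 3) ℝ} {v : R3} (hA : 0 < A.det)
    (h : N = M.affineImage A v hA.ne') : OrientedlyAffinelyEquivalent N M := by
  have hinv (p : R3) : A⁻¹.mulVec (affMap A v p + -v) = p + 0 := by
    rw [affMap_apply, add_neg_cancel_right, Matrix.mulVec_mulVec,
      Matrix.nonsing_inv_mul _ (isUnit_iff_ne_zero.mpr hA.ne'), Matrix.one_mulVec, add_zero]
  refine ⟨A⁻¹, -v, 0, ?_, ?_, ?_⟩
  · rw [Matrix.det_nonsing_inv, Ring.inverse_eq_inv']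
    exact inv_pos.mpr hA
  · subst h
    simp only [affineImage, Set.image_image, hinv]
  · subst h
    simp only [affineImage, Set.image_image, Sym2.map_map]
    refine Set.image_congr fun e _ => ?_
    rw [translateEdge]
    congr 1
    funext p
    exact hinv p

/-- The affine map from the first image to the second has linear part `B * A⁻¹`, of positive
determinant, so a single isotopy joins them directly. -/
lemma periodicallyIsotopic_of_affineImages {M : LinearPeriodicNet}
    {A B : Matrix (Fin 3) (Fin 3) ℝ} (u v : R3) (hA : 0 < A.det) (hB : 0 < B.det) :
    PeriodicallyIsotopic (M.affineImage A u hA.ne') (M.affineImage B v hB.ne') := by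
  have hu : IsUnit A.det := isUnit_iff_ne_zero.mpr hA.ne'
  have hdet : 0 < (B * A⁻¹).det := by
    rw [Matrix.det_mul, Matrix.det_nonsing_inv, Ring.inverse_eq_inv']
    exact mul_pos hB (inv_pos.mpr hA)
  have h := (M.affineImage A u hA.ne').periodicallyIsotopic_affineImage hdet
    (v - (B * A⁻¹).mulVec u)
  rw [affineImage_affineImage] at h
  simpa only [Matrix.mul_assoc, Matrix.nonsing_inv_mul _ hu, mul_one, add_sub_cancel] using h

end PeriodicNets

/-! ### Conclusion: the model index is a complete invariant -/

open PeriodicNets in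
theorem corollary8p7 :
    -- periodic isotopy is an equivalence relation on these nets, with exactly 19 classes
    Equivalence (fun N N' : PeriodicNets.DepthOneLatticeNet =>
      PeriodicNets.PeriodicallyIsotopic N.1 N'.1) ∧
    Nat.card (Quot (fun N N' : PeriodicNets.DepthOneLatticeNet =>
      PeriodicNets.PeriodicallyIsotopic N.1 N'.1)) = 19 ∧
    -- the 19 model nets belong to the family, represent all oriented affine equivalence classes,
    -- and have pairwise nonisomorphic structure graphs
    ∃ M : Fin 19 → PeriodicNets.DepthOneLatticeNet,
      (∀ i, (M i).1.nodes = Set.range PeriodicNets.intPoint ∧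
        (M i).1.edges = PeriodicNets.modelEdges (PeriodicNets.modelWord i)) ∧
      (∀ N : PeriodicNets.DepthOneLatticeNet,
        ∃ i, PeriodicNets.OrientedlyAffinelyEquivalent N.1 (M i).1) ∧
      (∀ i j, Nonempty ((M i).1.structureGraph ≃g (M j).1.structureGraph) → i = j) := by
  let M (i : Fin 19) : DepthOneLatticeNet :=
    ⟨modelNet i, isConnected_modelNet i, adjacencyDepth_modelNet i,
      hasSingleVertexQuotient_modelNet i⟩
  have hM (i j : Fin 19) (h : Nonempty ((M i).1.structureGraph ≃g (M j).1.structureGraph)) :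
      i = j := by
    obtain ⟨φ⟩ := h
    exact eq_of_structureGraph_iso rfl rfl rfl rfl φ
  have hex (N : DepthOneLatticeNet) := exists_eq_affineImage_modelNet N.2.1 N.2.2.1 N.2.2.2
  choose ι A v hA hN using hex
  have hMN (N : DepthOneLatticeNet) : PeriodicallyIsotopic (M (ι N)).1 N.1 := by
    rw [hN N]
    exact (modelNet (ι N)).periodicallyIsotopic_affineImage (hA N) (v N)
  -- Isotopic nets have isomorphic structure graphs, hence so do their models, whose indices then
  -- agree. Nets with the same index are affine images of one model.
  have hiff (N N' : DepthOneLatticeNet) : PeriodicallyIsotopic N.1 N'.1 ↔ ι N = ι N' := by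
    constructor
    · intro h
      obtain ⟨φ⟩ := (hMN N).nonempty_iso
      obtain ⟨φ'⟩ := (hMN N').nonempty_iso
      obtain ⟨ψ⟩ := h.nonempty_iso
      exact hM _ _ ⟨(φ.trans ψ).trans φ'.symm⟩
    · intro h
      have h' := hN N'
      rw [← h] at h'
      rw [hN N, h']
      exact periodicallyIsotopic_of_affineImages _ _ (hA N) (hA N')
  -- The index was chosen arbitrarily, but the graph invariant forces a model to receive its own
  -- index.
  have hιM (i : Fin 19) : ι (M i) = i := hM _ _ (hMN (M i)).nonempty_iso
  refine ⟨⟨fun N => (hiff N N).mpr rfl, fun h => (hiff _ _).mpr ((hiff _ _).mp h).symm,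
    fun h h' => (hiff _ _).mpr (((hiff _ _).mp h).trans ((hiff _ _).mp h'))⟩, ?_, M,
    fun i => ⟨rfl, rfl⟩,
    fun N => ⟨ι N, orientedlyAffinelyEquivalent_of_eq_affineImage (hA N) (hN N)⟩, hM⟩
  have e : Quot (fun N N' : DepthOneLatticeNet => PeriodicallyIsotopic N.1 N'.1) ≃ Fin 19 :=
    { toFun := Quot.lift ι fun N N' h => (hiff N N').mp h
      invFun := fun i => Quot.mk _ (M i)
      left_inv := by
        rintro ⟨N⟩
        exact Quot.sound ((hiff _ _).mpr (hιM (ι N)))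
      right_inv := hιM }
  rw [Nat.card_congr e, Nat.card_fin]
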